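/- **Setting.** Let $\mathcal X\subset\mathbb R^d$ be a bounded open set and $\mathcal H$ a reproducing kernel Hilbert space of real functions on $\mathcal X$ whose kernel $k$ is of class $C^4$ on $\mathcal X\times\mathcal X$; write $k_x=k(x,\cdot)$. Assume that for some integer $s\ge 1$ the space $\mathcal H$ contains the restrictions to $\mathcal X$ of all $C^s$ functions on $\mathbb R^d$. Let $x_1,\dots,x_n\in\mathcal X$ ($n\ge 1$), $y\in\mathbb R^n$, $v_1,\dots,v_\ell\in\mathcal X$, $\rho>0$, and suppose that either $\lambda_2>0,\ \lambda_1\ge 0$ or $\lambda_2=0,\ \lambda_1>0$. Let $R\in\mathbb R^{\ell\times\ell}$ be upper triangular with $R^TR=[k(v_i,v_j)]_{i,j}$, and put $\Psi_j=R_{:,j}\otimes I_d\in\mathbb R^{\ell d\times d}$. For $v\in\mathcal X$ let $\partial_{pq}k_v=\frac{\partial^2 k(s,\cdot)}{\partial s_p\partial s_q}\big|_{s=v}$. Set $K=[k(x_i,x_j)]_{i,j}$, $W=(\frac1nK+\rho I_n)^{-1}$, and $$[\partial^2_{pq}K(X,V)]_{ij}=\frac{\partial^2k(x_i,v_j)}{\partial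 v_j^p\partial v_j^q},\qquad [\partial^4_{pqrs}K(V,V)]_{ij}=\frac{\partial^4k(v_i,v_j)}{\partial v_i^p\partial v_i^q\partial v_j^r\partial v_j^s}.$$ For symmetric $M\in\mathbb R^{\ell d\times\ell d}$ with eigendecomposition $M=U\Sigma U^T$ let $[M]_-=U\max(0,-\Sigma)U^T$, and let $$\Omega^*(M)=\begin{cases}\frac1{2\lambda_2}\|[M+\lambda_1I_{\ell d}]_-\|_F^2&\text{if }\lambda_2>0,\\ 0\ \text{ if } M+\lambda_1 I_{\ell d}\succeq0,\quad +\infty\ \text{ otherwise}&\text{if }\lambda_2=0.\end{cases}$$ For $\Gamma=(\Gamma^{(1)},\dots,\Gamma^{(\ell)})$ a tuple of symmetric $d\times d$ matrices write $\Gamma^{(\cdot)}_{pq}=[\Gamma^{(j)}_{pq}]_{j}\in\mathbb R^\ell$. **Primal problem.** Minimize over $f\in\mathcal H$ and positive semidefinite $B\in\mathbb R^{\ell d\times\ell d}$ $$\frac1n\sum_{i=1}^n(y_i-f(x_i))^2+\lambda_1\operatorname{tr}B+\frac{\lambda_2}2\|B\|_F^2+\rho\|f\|_{\mathcal H}^2\quad\text{s.t.}\quad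 \sum_{p,q=1}^d\langle f,\partial_{pq}k_{v_j}\rangle e_pe_q^T=\Psi_j^TB\Psi_j,\ \ j=1,\dots,\ell .$$ **Dual objective.** For $\Gamma$ a tuple of symmetric matrices, $$\begin{aligned}\mathcal D(\Gamma)={}&\frac1{4\rho}\sum_{p,q,r,s}(\Gamma^{(\cdot)}_{pq})^T\partial^4_{pqrs}K(V,V)\Gamma^{(\cdot)}_{rs}-\frac1{4n\rho}\sum_{p,q,r,s}(\Gamma^{(\cdot)}_{pq})^T\partial^2_{pq}K(X,V)^TW\,\partial^2_{rs}K(X,V)\Gamma^{(\cdot)}_{rs}\\&+\frac1{2n\rho}y^T\Big(I_n+\rho W-\frac1nKW\Big)\sum_{p,q}\partial^2_{pq}K(X,V)\Gamma^{(\cdot)}_{pq}+\frac1ny^T\Big(\frac1nKW-I_n\Big)y+\Omega^*\Big(\sum_{j}\Psi_j\Gamma^{(j)}\Psi_j^T\Big).\end{aligned}$$ **Proposition.** 1. For all $u\in\mathcal X$ and $p,q$, $\partial_{pq}k_u\in\mathcal H$ and $\langle f,\partial_{pq}k_u\rangle=\frac{\partial^2 f}{\partial u_p\partial u_q}(u)$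 for all $f\in\mathcal H$. 2. $-\mathcal D$ is the Lagrangian dual function: for every tuple $\Gamma$ of symmetric matrices, $-\mathcal D(\Gamma)$ is the infimum over $f\in\mathcal H$, $B\succeq0$ of the primal objective minus $\langle f,\sum_{j,p,q}\Gamma^{(j)}_{pq}\partial_{pq}k_{v_j}\rangle$ plus $\sum_j\langle\Gamma^{(j)},\Psi_j^TB\Psi_j\rangle_F$. 3. Strong duality holds: the primal problem has a minimizer, $\mathcal D$ has a minimizer over tuples of symmetric matrices, and the primal optimal value equals $-\min_\Gamma\mathcal D(\Gamma)$. 4. If $\Gamma$ minimizes $\mathcal D$ and $(f^\star,B^\star)$ is a primal minimizer, then $$f^\star=\sum_{i=1}^n\Big(\alpha_i+\frac12\sum_{p,q}\delta^{(i)}_{pq}\Big)k_{x_i}+\frac1{2\rho}\sum_{j=1}^\ell\sum_{p,q}\Gamma^{(j)}_{pq}\,\partial_{pq}k_{v_j},$$ where $\alpha=\frac1nWy$ and $\delta^{(\cdot)}_{pq}=-\frac1{n\rho}W\,\partial^2_{pq}K(X,V)\Gamma^{(\cdot)}_{pq}\in\mathbb R^n$. -/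

import Mathlib

open scoped Matrix

noncomputable section

namespace CvxReg

/-- The Euclidean space `ℝ^d`. -/
abbrev E (d : ℕ) := EuclideanSpace ℝ (Fin d)

/-- First order partial derivative `∂F/∂z_p`. -/
def pd {d : ℕ} (p : Fin d) (F : E d → ℝ) (z : E d) : ℝ :=
  lineDeriv ℝ F z (EuclideanSpace.single p 1)

/-- Second order partial derivative `∂²F/∂z_p∂z_q`. -/
def pd2 {d : ℕ} (p q : Fin d) (F : E d → ℝ) (z : E d) : ℝ :=
  pd p (pd q F) z

/-- Extension by zero of a function on `X ⊆ ℝ^d`. For an open set `X` the extension has the same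
partial derivatives as the function at the points of `X`. -/
def ext0 {d : ℕ} {X : Set (E d)} (f : X → ℝ) : E d → ℝ :=
  Function.extend Subtype.val f 0

section Kernel

variable {d : ℕ} {X : Set (E d)}
variable (H : Type*) [NormedAddCommGroup H] [InnerProductSpace ℝ H] [CompleteSpace H]
variable [RKHS ℝ H X ℝ]

/-- The function `k_x = k(x, ·)`, as an element of `H`. -/
def kx (x : X) : H := RKHS.kerFun H x (1 : ℝ)

/-- The scalar reproducing kernel `k(s, t)` of `H` (its value is `0` when `s ∉ X` or `t ∉ X`). -/
def ker (s t : E d) : ℝ :=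
  ext0 (fun s' : X => ext0 (fun t' : X => RKHS.kernel H s' t' (1 : ℝ)) t) s

/-- The function `∂_{pq} k_v : z ↦ ∂²k(s, z)/∂s_p∂s_q |_{s = v}`, as an element of `H`
(it is unique if it exists, as elements of `H` are determined by their values). -/
def dkx (v : X) (p q : Fin d) : H :=
  Classical.epsilon fun D : H => ∀ z : X, D z = pd2 p q (fun s => ker H s z) v

/-- The matrix `[k(a_i, a_j)]_{ij}`. -/
def gram {m : ℕ} (a : Fin m → X) : Matrix (Fin m) (Fin m) ℝ :=
  Matrix.of fun i j => ker H (a i : E d) (a j)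

/-- The matrix `∂²_{pq} K(X, V)`, with entries `∂²k(x_i, v_j)/∂v_j^p∂v_j^q`. -/
def d2K {n l : ℕ} (x : Fin n → X) (v : Fin l → X) (p q : Fin d) : Matrix (Fin n) (Fin l) ℝ :=
  Matrix.of fun i j => pd2 p q (fun t => ker H (x i) t) (v j)

/-- The matrix `∂⁴_{pqrs} K(V, V)`, with entries `∂⁴k(v_i, v_j)/∂v_i^p∂v_i^q∂v_j^r∂v_j^s`. -/
def d4K {l : ℕ} (v : Fin l → X) (p q r s : Fin d) : Matrix (Fin l) (Fin l) ℝ :=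
  Matrix.of fun i j => pd2 p q (fun u => pd2 r s (fun t => ker H u t) (v j)) (v i)

/-- The matrix `W = (K / n + ρ I)⁻¹`, with `K = [k(x_i, x_j)]_{ij}`. -/
def W {n : ℕ} (x : Fin n → X) (ρ : ℝ) : Matrix (Fin n) (Fin n) ℝ :=
  ((1 / (n : ℝ)) • gram H x + ρ • (1 : Matrix (Fin n) (Fin n) ℝ))⁻¹

end Kernel

/-- `R` is an upper triangular Cholesky factor of `K`. -/
def IsCholesky {l : ℕ} (R K : Matrix (Fin l) (Fin l) ℝ) : Prop :=
  R.BlockTriangular id ∧ Rᵀ * R = K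

/-- `Ψ_j = R_{:,j} ⊗ I_d`, a matrix of size `ld × d`. -/
def Psi {l : ℕ} (d : ℕ) (R : Matrix (Fin l) (Fin l) ℝ) (j : Fin l) :
    Matrix (Fin l × Fin d) (Fin d) ℝ :=
  Matrix.of fun a q => R a.1 j * (1 : Matrix (Fin d) (Fin d) ℝ) a.2 q

/-- The squared Frobenius norm. -/
def frobSq {ι : Type*} [Fintype ι] (M : Matrix ι ι ℝ) : ℝ := ∑ i, ∑ j, M i j ^ 2

open Classical in
/-- The negative part `[M]_- = U max(0, -Σ) Uᵀ` of a symmetric matrix `M = U Σ Uᵀ`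
(with the value `0` for matrices that are not symmetric). -/
def symNegPart {ι : Type*} [Fintype ι] [DecidableEq ι] (M : Matrix ι ι ℝ) : Matrix ι ι ℝ :=
  if h : M.IsHermitian then
    (h.eigenvectorUnitary : Matrix ι ι ℝ) *
      Matrix.diagonal (fun i => max 0 (-(h.eigenvalues i))) *
      (h.eigenvectorUnitary : Matrix ι ι ℝ)ᵀ
  else 0

open Classical in
/-- `Ω*(M)`: for `λ₂ > 0` it is `‖[M + λ₁ I]_-‖_F² / (2 λ₂)`, and for `λ₂ = 0` it is the indicator
function (with values `0` and `+∞`) of the condition `M + λ₁ I ⪰ 0`. -/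
def OmegaStar {ι : Type*} [Fintype ι] [DecidableEq ι] (lam₁ lam₂ : ℝ) (M : Matrix ι ι ℝ) : EReal :=
  if 0 < lam₂ then
    ((1 / (2 * lam₂) * frobSq (symNegPart (M + lam₁ • (1 : Matrix ι ι ℝ))) : ℝ) : EReal)
  else if (M + lam₁ • (1 : Matrix ι ι ℝ)).PosSemidef then 0 else ⊤

/-- The set of `l`-tuples of symmetric `d × d` matrices. -/
def SymTuples (l d : ℕ) : Set (Fin l → Matrix (Fin d) (Fin d) ℝ) :=
  {Γ | ∀ j, (Γ j).IsSymm}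

/-- The vector `Γ_{pq}^{(·)} = [Γ^{(j)}_{pq}]_j`. -/
def slice {l d : ℕ} (Γ : Fin l → Matrix (Fin d) (Fin d) ℝ) (p q : Fin d) : Fin l → ℝ :=
  fun j => Γ j p q

section Problem

variable {d : ℕ} {X : Set (E d)}
variable (H : Type*) [NormedAddCommGroup H] [InnerProductSpace ℝ H] [CompleteSpace H]
variable [RKHS ℝ H X ℝ]

/-- The objective of the convex regression problem. -/
def primalObj {n l : ℕ} (x : Fin n → X) (y : Fin n → ℝ) (ρ lam₁ lam₂ : ℝ)
    (f : H) (B : Matrix (Fin l × Fin d) (Fin l × Fin d) ℝ) : ℝ :=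
  1 / (n : ℝ) * ∑ i, (y i - f (x i)) ^ 2 + lam₁ * B.trace + lam₂ / 2 * frobSq B + ρ * ‖f‖ ^ 2

/-- The feasible pairs `(f, B)`: `B ⪰ 0` and
`∑_{p,q} ⟪f, ∂_{pq} k_{v_j}⟫ e_p e_qᵀ = Ψ_jᵀ B Ψ_j` for all `j`. -/
def feasible {l : ℕ} (v : Fin l → X) (R : Matrix (Fin l) (Fin l) ℝ) :
    Set (H × Matrix (Fin l × Fin d) (Fin l × Fin d) ℝ) :=
  {P | P.2.PosSemidef ∧ ∀ j,
    (Matrix.of fun p q => inner ℝ P.1 (dkx H (v j) p q)) = (Psi d R j)ᵀ * P.2 * Psi d R j}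

/-- The Lagrangian of the convex regression problem. -/
def lagrangian {n l : ℕ} (x : Fin n → X) (y : Fin n → ℝ) (v : Fin l → X)
    (R : Matrix (Fin l) (Fin l) ℝ) (ρ lam₁ lam₂ : ℝ)
    (f : H) (B : Matrix (Fin l × Fin d) (Fin l × Fin d) ℝ)
    (Γ : Fin l → Matrix (Fin d) (Fin d) ℝ) : ℝ :=
  primalObj H x y ρ lam₁ lam₂ f B
    - inner ℝ f (∑ j, ∑ p, ∑ q, Γ j p q • dkx H (v j) p q)
    + ∑ j, ((Γ j)ᵀ * ((Psi d R j)ᵀ * B * Psi d R j)).trace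

/-- The finite (quadratic) part of the dual objective. -/
def dualQuad {n l : ℕ} (x : Fin n → X) (y : Fin n → ℝ) (v : Fin l → X) (ρ : ℝ)
    (Γ : Fin l → Matrix (Fin d) (Fin d) ℝ) : ℝ :=
  1 / (4 * ρ) * ∑ p, ∑ q, ∑ r, ∑ s, slice Γ p q ⬝ᵥ (d4K H v p q r s *ᵥ slice Γ r s)
  - 1 / (4 * n * ρ) * ∑ p, ∑ q, ∑ r, ∑ s,
      slice Γ p q ⬝ᵥ (((d2K H x v p q)ᵀ * W H x ρ * d2K H x v r s) *ᵥ slice Γ r s)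
  + 1 / (2 * n * ρ) *
      (y ⬝ᵥ ((1 + ρ • W H x ρ - (1 / (n : ℝ)) • (gram H x * W H x ρ)) *ᵥ
        ∑ p, ∑ q, d2K H x v p q *ᵥ slice Γ p q))
  + 1 / (n : ℝ) * (y ⬝ᵥ (((1 / (n : ℝ)) • (gram H x * W H x ρ) - 1) *ᵥ y))

/-- The objective of the dual problem. -/
def dualObj {n l : ℕ} (x : Fin n → X) (y : Fin n → ℝ) (v : Fin l → X)
    (R : Matrix (Fin l) (Fin l) ℝ) (ρ lam₁ lam₂ : ℝ)
    (Γ : Fin l → Matrix (Fin d) (Fin d) ℝ) : EReal :=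
  (dualQuad H x y v ρ Γ : EReal)
    + OmegaStar lam₁ lam₂ (∑ j, Psi d R j * Γ j * (Psi d R j)ᵀ)

/-- `α = W y / n`. -/
def alpha {n : ℕ} (x : Fin n → X) (y : Fin n → ℝ) (ρ : ℝ) : Fin n → ℝ :=
  (1 / (n : ℝ)) • (W H x ρ *ᵥ y)

/-- `δ_{pq} = - W ∂²_{pq}K(X, V) Γ_{pq} / (n ρ)`. -/
def delta {n l : ℕ} (x : Fin n → X) (v : Fin l → X) (ρ : ℝ)
    (Γ : Fin l → Matrix (Fin d) (Fin d) ℝ) (p q : Fin d) : Fin n → ℝ :=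
  (-(1 / (n * ρ))) • ((W H x ρ * d2K H x v p q) *ᵥ slice Γ p q)

/-- The function `f⋆` attached to a dual variable `Γ`. -/
def fStar {n l : ℕ} (x : Fin n → X) (y : Fin n → ℝ) (v : Fin l → X) (ρ : ℝ)
    (Γ : Fin l → Matrix (Fin d) (Fin d) ℝ) : H :=
  ∑ i, (alpha H x y ρ i + 1 / 2 * ∑ p, ∑ q, delta H x v ρ Γ p q i) • kx H (x i)
    + (1 / (2 * ρ)) • ∑ j, ∑ p, ∑ q, Γ j p q • dkx H (v j) p q

end Problem

end CvxReg

end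

open CvxReg

/-! The inner product of `k_s` and `k_t` is `k(s, t)`, so smoothness of the kernel is smoothness of
the curve `s ↦ k_s` in `H`: difference quotients are Cauchy as soon as the mixed second differences
of their Gram kernel converge. Each differentiation costs two orders of the kernel, so `C⁴` allows
exactly two. Continuity of `⟪f, ·⟫` then gives the reproducing property for second derivatives
(`inner_dkx`), and all the constraints become linear in `(f, B)`.

For symmetric `Γ` the Lagrangian splits into a function of `f` and a function of `B`. The `f` part
is ridge regression with a linear term; completing the square gives its minimizer, which is `fStar`,
and its value `-dualQuad` (`ridgeObj_eq`, `ridgeObj_ridgeMin`). The `B` part is a linear form plus a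
quadratic over the semidefinite cone, with infimum `-Ω*` (`iInf_add_conePenalty`).

Strong duality rests on a Slater point with `B = I`: since `Ψ_jᵀ Ψ_j = k(v_j, v_j) I`, it suffices
that some `f` in `H` has Hessian `k(v_j, v_j) I` at each `v_j`, and a smooth function glued from
bumps does. A multiplier then comes from the M. Riesz extension theorem
(`exists_lagrange_multiplier`), which is purely algebraic and so does not see the dimension of `H`.
The primal minimum is attained because orthogonal projection reduces the problem to a
finite-dimensional one (`exists_representer`), where the objective is coercive.

Finally, the Lagrangian exceeds its minimum over `f` by at least `ρ ‖f - fStar‖²`; a zero duality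
gap leaves no room for this excess. -/

noncomputable section

namespace CvxReg

open Filter Topology

/-! ### Differentiability of Hilbert-space valued maps from their Gram kernel -/

section InnerDeriv

variable {G : Type*} [NormedAddCommGroup G] [InnerProductSpace ℝ G]

/-- A mixed second difference of a `C²` function of two real variables is close to the product of
the increments with the mixed second derivative. -/
lemma mixed_diff_bound {κ : ℝ × ℝ → ℝ} (hκ : ContDiffAt ℝ 2 κ (0, 0)) :
    ∃ c : ℝ, ∀ ε > 0, ∃ δ > 0, ∀ a b : ℝ, |a| < δ → |b| < δ →
      |κ (a, b) - κ (a, 0) - κ (0, b) + κ (0, 0) - a * b * c| ≤ ε * |a| * |b| := by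
  let g : ℝ × ℝ → ℝ := fun z => fderiv ℝ κ z (1, 0)
  let m : ℝ × ℝ → ℝ := fun z => fderiv ℝ g z (0, 1)
  have hg : ContDiffAt ℝ 1 g (0, 0) :=
    (hκ.fderiv_right (m := 1) (by norm_num)).clm_apply contDiffAt_const
  have hm : ContinuousAt m (0, 0) :=
    ((hg.fderiv_right (m := 0) (by norm_num)).clm_apply contDiffAt_const).continuousAt
  refine ⟨m (0, 0), fun ε hε => ?_⟩
  have h1 : ∀ᶠ z in 𝓝 ((0, 0) : ℝ × ℝ), DifferentiableAt ℝ κ z := by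
    filter_upwards [hκ.eventually (by simp)] with z hz
    exact hz.differentiableAt (by norm_num)
  have h2 : ∀ᶠ z in 𝓝 ((0, 0) : ℝ × ℝ), DifferentiableAt ℝ g z := by
    filter_upwards [hg.eventually (by simp)] with z hz
    exact hz.differentiableAt (by norm_num)
  have h3 : ∀ᶠ z in 𝓝 ((0, 0) : ℝ × ℝ), |m z - m (0, 0)| < ε := by
    have := Metric.tendsto_nhds.1 hm ε hε
    simpa [Real.dist_eq] using this
  obtain ⟨δ, hδ, hb⟩ := Metric.eventually_nhds_iff_ball.1 (h1.and (h2.and h3))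
  have hb' : ∀ a b : ℝ, |a| < δ → |b| < δ → DifferentiableAt ℝ κ (a, b) ∧
      DifferentiableAt ℝ g (a, b) ∧ |m (a, b) - m (0, 0)| < ε := by
    intro a b ha hb1
    refine hb (a, b) ?_
    rw [Metric.mem_ball, Prod.dist_eq]
    simpa [Real.dist_eq] using ⟨ha, hb1⟩
  refine ⟨δ, hδ, fun a b ha hb1 => ?_⟩
  have hball : ∀ t : ℝ, t ∈ Metric.ball (0 : ℝ) δ ↔ |t| < δ := fun t => by
    simp [Real.norm_eq_abs]
  -- Two mean value inequalities: this one in the second variable for `∂₁κ`, the next in the first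
  -- variable for `κ(·, b) - κ(·, 0)`.
  have key1 : ∀ a' : ℝ, |a'| < δ → |g (a', b) - g (a', 0) - b * m (0, 0)| ≤ ε * |b| := by
    intro a' ha'
    have := (convex_ball (0 : ℝ) δ).norm_image_sub_le_of_norm_hasDerivWithin_le
      (f := fun t => g (a', t) - t * m (0, 0)) (f' := fun t => m (a', t) - m (0, 0))
      (C := ε) (x := 0) (y := b) (fun t ht => ?_) (fun t ht => ?_) (by simpa using hδ)
      ((hball b).2 hb1)
    · simp only [zero_mul, sub_zero, Real.norm_eq_abs] at this
      convert this using 2; ring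
    · have hd := (hb' a' t ha' ((hball t).1 ht)).2.1.hasFDerivAt
      have hc : HasDerivAt (fun t : ℝ => ((a', t) : ℝ × ℝ)) (0, 1) t :=
        (hasDerivAt_const t a').prodMk (hasDerivAt_id t)
      have := (hd.comp_hasDerivAt t hc).sub ((hasDerivAt_id t).mul_const (m (0, 0)))
      rw [one_mul] at this
      exact this.hasDerivWithinAt
    · exact (hb' a' t ha' ((hball t).1 ht)).2.2.le
  have := (convex_ball (0 : ℝ) δ).norm_image_sub_le_of_norm_hasDerivWithin_le
      (f := fun t => κ (t, b) - κ (t, 0) - t * (b * m (0, 0)))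
      (f' := fun t => g (t, b) - g (t, 0) - b * m (0, 0))
      (C := ε * |b|) (x := 0) (y := a) (fun t ht => ?_) (fun t ht => key1 t ((hball t).1 ht))
      (by simpa using hδ) ((hball a).2 ha)
  · simp only [zero_mul, sub_zero, Real.norm_eq_abs] at this
    calc _ = |κ (a, b) - κ (a, 0) - a * (b * m (0, 0)) - (κ (0, b) - κ (0, 0))| := by
          congr 1; ring
      _ ≤ _ := this
      _ = _ := by ring
  · have hd : ∀ b' : ℝ, |b'| < δ → HasDerivAt (fun t : ℝ => κ (t, b')) (g (t, b')) t := by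
      intro b' hb2
      have hc : HasDerivAt (fun t : ℝ => ((t, b') : ℝ × ℝ)) (1, 0) t :=
        (hasDerivAt_id t).prodMk (hasDerivAt_const t b')
      exact (hb' t b' ((hball t).1 ht) hb2).1.hasFDerivAt.comp_hasDerivAt t hc
    have := ((hd b hb1).sub (hd 0 (by simpa using hδ))).sub
      ((hasDerivAt_id t).mul_const (b * m (0, 0)))
    rw [one_mul] at this
    exact this.hasDerivWithinAt

/-- A curve in a Hilbert space is differentiable where its Gram kernel is `C²`. -/
lemma differentiableAt_of_gram [CompleteSpace G] {ψ : ℝ → G}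
    (hψ : ContDiffAt ℝ 2 (fun z : ℝ × ℝ => (inner ℝ (ψ z.1) (ψ z.2) : ℝ)) (0, 0)) :
    DifferentiableAt ℝ ψ 0 := by
  obtain ⟨c, hc⟩ := mixed_diff_bound hψ
  let D : ℝ → G := fun h => h⁻¹ • (ψ h - ψ 0)
  have hD : ∀ ε > 0, ∃ δ > 0, ∀ a b : ℝ, a ≠ 0 → b ≠ 0 → |a| < δ → |b| < δ →
      |(inner ℝ (D a) (D b) : ℝ) - c| ≤ ε := by
    intro ε hε
    obtain ⟨δ, hδ, h⟩ := hc ε hε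
    refine ⟨δ, hδ, fun a b ha hb ha' hb' => ?_⟩
    have h1 := h a b ha' hb'
    have e : (inner ℝ (D a) (D b) : ℝ) - c = (a * b)⁻¹ * ((inner ℝ (ψ a) (ψ b) : ℝ)
        - inner ℝ (ψ a) (ψ 0) - inner ℝ (ψ 0) (ψ b) + inner ℝ (ψ 0) (ψ 0) - a * b * c) := by
      simp only [D, inner_smul_left, inner_smul_right, inner_sub_left, inner_sub_right,
        RCLike.conj_to_real]
      field_simp
      ring
    rw [e, abs_mul, abs_inv, abs_mul, inv_mul_le_iff₀ (by positivity)]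
    linarith
  have hcau : Cauchy (map D (𝓝[≠] 0)) := by
    rw [Metric.cauchy_iff]
    refine ⟨inferInstance, fun ε hε => ?_⟩
    -- In `‖D a - D b‖²` the limit `c` cancels, leaving four errors of at most `ε² / 8` each, hence
    -- at most `ε² / 2 < ε²`.
    obtain ⟨δ, hδ, h⟩ := hD (ε ^ 2 / 8) (by positivity)
    refine ⟨D '' {a | a ≠ 0 ∧ |a| < δ}, image_mem_map ?_, ?_⟩
    · have : Metric.ball (0 : ℝ) δ ∩ {0}ᶜ ∈ 𝓝[≠] (0 : ℝ) :=
        inter_mem (mem_nhdsWithin_of_mem_nhds (Metric.ball_mem_nhds _ hδ)) self_mem_nhdsWithin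
      filter_upwards [this] with a ha
      exact ⟨ha.2, by simpa [Real.norm_eq_abs] using ha.1⟩
    · rintro _ ⟨a, ⟨ha, ha'⟩, rfl⟩ _ ⟨b, ⟨hb, hb'⟩, rfl⟩
      have h1 := abs_le.1 (h a a ha ha ha' ha')
      have h2 := abs_le.1 (h a b ha hb ha' hb')
      have h3 := abs_le.1 (h b b hb hb hb' hb')
      have h4 : ‖D a - D b‖ ^ 2 = (inner ℝ (D a) (D a) : ℝ) - 2 * inner ℝ (D a) (D b)
          + inner ℝ (D b) (D b) := by
        rw [norm_sub_sq_real, real_inner_self_eq_norm_sq, real_inner_self_eq_norm_sq]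
      rw [dist_eq_norm]
      refine lt_of_pow_lt_pow_left₀ 2 hε.le ?_
      rw [h4]
      nlinarith [sq_nonneg ε, sq_pos_of_pos hε]
  obtain ⟨L, hL⟩ := CompleteSpace.complete hcau
  have : HasDerivAt ψ L 0 := by
    rw [hasDerivAt_iff_tendsto_slope_zero]
    simpa [Tendsto, D] using hL
  exact this.differentiableAt

variable {V : Type*} [NormedAddCommGroup V] [NormedSpace ℝ V]

lemma hasLineDerivAt_of_gram [CompleteSpace G] {Φ : V → G} {U : Set V} (hU : IsOpen U)
    (hΦ : ContDiffOn ℝ 2 (fun z : V × V => (inner ℝ (Φ z.1) (Φ z.2) : ℝ)) (U ×ˢ U))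
    {u : V} (hu : u ∈ U) (e : V) :
    HasLineDerivAt ℝ Φ (lineDeriv ℝ Φ u e) u e := by
  refine LineDifferentiableAt.hasLineDerivAt ?_
  refine differentiableAt_of_gram (ψ := fun t : ℝ => Φ (u + t • e)) ?_
  have h1 : ContDiffAt ℝ 2 (fun z : V × V => (inner ℝ (Φ z.1) (Φ z.2) : ℝ))
      (u + (0 : ℝ) • e, u + (0 : ℝ) • e) :=
    hΦ.contDiffAt ((hU.prod hU).mem_nhds (by simpa using hu))
  exact h1.comp (f := fun z : ℝ × ℝ => (u + z.1 • e, u + z.2 • e)) (0, 0) (by fun_prop)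

lemma HasLineDerivAt.inner_const_left {Φ : V → G} {L : G} {u e : V}
    (h : HasLineDerivAt ℝ Φ L u e) (f : G) :
    HasLineDerivAt ℝ (fun s => (inner ℝ f (Φ s) : ℝ)) (inner ℝ f L) u e :=
  (innerSL ℝ f).hasFDerivAt.comp_hasDerivAt (0 : ℝ) (f := fun t : ℝ => Φ (u + t • e)) h

lemma HasLineDerivAt.inner_const_right {Φ : V → G} {L : G} {u e : V}
    (h : HasLineDerivAt ℝ Φ L u e) (f : G) :
    HasLineDerivAt ℝ (fun s => (inner ℝ (Φ s) f : ℝ)) (inner ℝ L f) u e := by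
  simpa only [real_inner_comm] using HasLineDerivAt.inner_const_left h f

/-- The Gram kernel of the derivative is the mixed second derivative of the Gram kernel, one
differentiation in each slot. This is what allows the differentiability criterion to be iterated. -/
lemma contDiffOn_gram_lineDeriv [CompleteSpace G] {Φ : V → G} {U : Set V} (hU : IsOpen U) {k : ℕ}
    (hΦ : ContDiffOn ℝ (k + 2) (fun z : V × V => (inner ℝ (Φ z.1) (Φ z.2) : ℝ)) (U ×ˢ U))
    (e : V) :
    ContDiffOn ℝ k (fun z : V × V =>
      (inner ℝ (lineDeriv ℝ Φ z.1 e) (lineDeriv ℝ Φ z.2 e) : ℝ)) (U ×ˢ U) := by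
  set κ := fun z : V × V => (inner ℝ (Φ z.1) (Φ z.2) : ℝ) with hκ
  have hUU := hU.prod hU
  have hline : ∀ u ∈ U, HasLineDerivAt ℝ Φ (lineDeriv ℝ Φ u e) u e := fun u hu =>
    hasLineDerivAt_of_gram hU (hΦ.of_le (by simp)) hu e
  let κ₁ : V × V → ℝ := fun z => fderiv ℝ κ z (0, e)
  have hκ₁ : ContDiffOn ℝ (k + 1) κ₁ (U ×ˢ U) :=
    (hΦ.fderiv_of_isOpen hUU (m := k + 1) (by rw [add_assoc]; norm_num)).clm_apply contDiffOn_const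
  have hκ₂ : ContDiffOn ℝ k (fun z => fderiv ℝ κ₁ z (e, 0)) (U ×ˢ U) :=
    (hκ₁.fderiv_of_isOpen hUU (m := k) le_rfl).clm_apply contDiffOn_const
  have e₁ : ∀ s ∈ U, ∀ t ∈ U, κ₁ (s, t) = inner ℝ (Φ s) (lineDeriv ℝ Φ t e) := by
    intro s hs t ht
    have hd : DifferentiableAt ℝ κ (s, t) :=
      (hΦ.contDiffAt (hUU.mem_nhds ⟨hs, ht⟩)).differentiableAt (by simp)
    have h1 := hd.hasFDerivAt.hasLineDerivAt (0, e)
    have h2 := HasLineDerivAt.inner_const_left (hline t ht) (Φ s)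
    refine HasDerivAt.unique (f := fun a : ℝ => (inner ℝ (Φ s) (Φ (t + a • e)) : ℝ)) (x := 0) ?_ h2
    have h3 : HasDerivAt (fun a : ℝ => κ ((s, t) + a • ((0 : V), e))) (κ₁ (s, t)) 0 := h1
    simpa [hκ] using h3
  refine hκ₂.congr ?_
  rintro ⟨s, t⟩ ⟨hs, ht⟩
  have hd : DifferentiableAt ℝ κ₁ (s, t) :=
    (hκ₁.contDiffAt (hUU.mem_nhds ⟨hs, ht⟩)).differentiableAt (by simp)
  have h1 : HasDerivAt (fun a : ℝ => κ₁ ((s, t) + a • (e, (0 : V)))) (fderiv ℝ κ₁ (s, t) (e, 0)) 0 :=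
    hd.hasFDerivAt.hasLineDerivAt (e, 0)
  have h2 : HasDerivAt (fun a : ℝ => (inner ℝ (Φ (s + a • e)) (lineDeriv ℝ Φ t e) : ℝ)) _ 0 :=
    HasLineDerivAt.inner_const_right (hline s hs) (lineDeriv ℝ Φ t e)
  refine h2.unique (h1.congr_of_eventuallyEq ?_)
  have hcont : Tendsto (fun a : ℝ => s + a • e) (𝓝 0) (𝓝 s) := by
    have : Continuous (fun a : ℝ => s + a • e) := by fun_prop
    simpa using this.tendsto 0
  filter_upwards [hcont.eventually (hU.mem_nhds hs)] with a ha
  simpa using (e₁ _ ha t ht).symm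

end InnerDeriv

/-! ### Second partial derivatives -/

section Partial

variable {d : ℕ}

lemma pd2_congr {F G : E d → ℝ} {u : E d} (h : F =ᶠ[𝓝 u] G) (p q : Fin d) :
    pd2 p q F u = pd2 p q G u := by
  refine Filter.EventuallyEq.lineDeriv_eq ?_
  filter_upwards [h.eventuallyEq_nhds] with z hz
  exact hz.lineDeriv_eq

lemma pd2_eq_fderiv {F : E d → ℝ} {u : E d} (h : ContDiffAt ℝ 2 F u) (p q : Fin d) :
    pd2 p q F u = fderiv ℝ (fderiv ℝ F) u (EuclideanSpace.single p 1)
      (EuclideanSpace.single q 1) := by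
  have h1 : pd q F =ᶠ[𝓝 u] fun z => fderiv ℝ F z (EuclideanSpace.single q 1) := by
    filter_upwards [h.eventually (by simp)] with z hz
    exact (hz.differentiableAt (by norm_num)).lineDeriv_eq_fderiv
  have h2 : DifferentiableAt ℝ (fderiv ℝ F) u :=
    (h.fderiv_right (m := 1) (by norm_num)).differentiableAt (by norm_num)
  have h3 := h2.hasFDerivAt.clm_apply (hasFDerivAt_const (EuclideanSpace.single q (1 : ℝ)) u)
  change lineDeriv ℝ (pd q F) u _ = _
  rw [h1.lineDeriv_eq, (h3.hasLineDerivAt _).lineDeriv]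
  simp

lemma pd2_symm {F : E d → ℝ} {u : E d} (h : ContDiffAt ℝ 2 F u) (p q : Fin d) :
    pd2 p q F u = pd2 q p F u := by
  rw [pd2_eq_fderiv h, pd2_eq_fderiv h]
  exact h.isSymmSndFDerivAt (by simp) _ _

end Partial

/-! ### The feature map and the reproducing property for second derivatives -/

section Feature

variable {d : ℕ} {X : Set (E d)}

lemma ext0_apply (f : X → ℝ) (x : X) : ext0 f x = f x :=
  Subtype.val_injective.extend_apply f (0 : E d → ℝ) x

lemma ext0_of_notMem (f : X → ℝ) {z : E d} (hz : z ∉ X) : ext0 f z = 0 :=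
  Function.extend_apply' f (0 : E d → ℝ) z (by rintro ⟨a, rfl⟩; exact hz a.2)

variable (H : Type*) [NormedAddCommGroup H] [InnerProductSpace ℝ H] [CompleteSpace H]
variable [RKHS ℝ H X ℝ]

/-- The map `z ↦ k_z`, extended by zero. -/
def feature : E d → H := Function.extend Subtype.val (fun x : X => kx H x) 0

lemma feature_apply (x : X) : feature H (x : E d) = kx H x :=
  Subtype.val_injective.extend_apply _ (0 : E d → H) x

variable {H}

lemma inner_kx (f : H) (x : X) : (inner ℝ f (kx H x) : ℝ) = f x := by
  simp [kx]

/-- Both sides vanish off `X`, so the reproducing property holds on all of `ℝ^d` and derivatives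
need no subtype. -/
lemma ext0_eq_inner (f : H) (z : E d) : ext0 f z = inner ℝ f (feature H z) := by
  by_cases hz : z ∈ X
  · lift z to X using hz
    rw [ext0_apply, feature_apply, inner_kx]
  · rw [ext0_of_notMem _ hz, feature, Function.extend_apply' _ _ _ (by rintro ⟨a, rfl⟩; exact hz a.2)]
    simp

variable (H)

lemma ker_eq_inner (s t : E d) : ker H s t = inner ℝ (feature H s) (feature H t) := by
  by_cases hs : s ∈ X
  · lift s to X using hs
    rw [ker, ext0_apply]
    have : (fun t' : X => RKHS.kernel H s t' (1 : ℝ)) = fun t' : X => (kx H s) t' := by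
      funext t'
      rw [← RKHS.kerFun_apply, ← inner_kx (kx H s) t', real_inner_comm, inner_kx]
      rfl
    rw [this, feature_apply]
    exact ext0_eq_inner (kx H s) t
  · rw [ker, ext0_of_notMem _ hs, feature,
      Function.extend_apply' _ _ s (by rintro ⟨a, rfl⟩; exact hs a.2)]
    simp

lemma ker_comm (s t : E d) : ker H s t = ker H t s := by
  rw [ker_eq_inner, ker_eq_inner, real_inner_comm]

/-- `∂_{pq} k_u` as an iterated derivative of the feature map. -/
def featureDeriv (p q : Fin d) (u : E d) : H :=
  lineDeriv ℝ (fun z => lineDeriv ℝ (feature H) z (EuclideanSpace.single q 1)) u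
    (EuclideanSpace.single p 1)

variable {H}

lemma inner_featureDeriv (hXo : IsOpen X)
    (hk : ContDiffOn ℝ 4 (fun z : E d × E d => ker H z.1 z.2) (X ×ˢ X))
    (u : X) (p q : Fin d) (f : H) :
    (inner ℝ f (featureDeriv H p q u) : ℝ) = pd2 p q (ext0 f) u := by
  simp only [ker_eq_inner] at hk
  have h1 : ContDiffOn ℝ 2 (fun z : E d × E d => (inner ℝ
      (lineDeriv ℝ (feature H) z.1 (EuclideanSpace.single q 1))
      (lineDeriv ℝ (feature H) z.2 (EuclideanSpace.single q 1)) : ℝ)) (X ×ˢ X) :=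
    contDiffOn_gram_lineDeriv (k := 2) hXo (by norm_num; exact hk) _
  have h2 := HasLineDerivAt.inner_const_left
    (hasLineDerivAt_of_gram (Φ := fun z => lineDeriv ℝ (feature H) z (EuclideanSpace.single q 1))
      hXo h1 u.2 (EuclideanSpace.single p 1)) f
  refine (h2.congr_of_eventuallyEq ?_).lineDeriv.symm
  filter_upwards [hXo.mem_nhds u.2] with z hz
  have h3 := HasLineDerivAt.inner_const_left
    (hasLineDerivAt_of_gram (Φ := feature H) hXo (hk.of_le (by norm_num)) hz
      (EuclideanSpace.single q 1)) f
  have h4 : ext0 f = fun s => (inner ℝ f (feature H s) : ℝ) := funext (ext0_eq_inner f)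
  rw [h4]
  exact h3.lineDeriv

lemma featureDeriv_apply (hXo : IsOpen X)
    (hk : ContDiffOn ℝ 4 (fun z : E d × E d => ker H z.1 z.2) (X ×ˢ X))
    (u z : X) (p q : Fin d) :
    featureDeriv H p q u z = pd2 p q (fun t => ker H t z) u := by
  rw [← inner_kx, real_inner_comm, inner_featureDeriv hXo hk]
  congr 1
  funext t
  rw [ext0_eq_inner, ker_eq_inner, feature_apply, real_inner_comm]

/-- `featureDeriv` is the witness that makes the choice in `dkx` meaningful. -/
lemma dkx_apply (hXo : IsOpen X)
    (hk : ContDiffOn ℝ 4 (fun z : E d × E d => ker H z.1 z.2) (X ×ˢ X))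
    (u : X) (p q : Fin d) (z : X) :
    dkx H u p q z = pd2 p q (fun t => ker H t z) u :=
  Classical.epsilon_spec (p := fun D : H => ∀ z : X, D z = pd2 p q (fun s => ker H s z) u)
    ⟨featureDeriv H p q u, fun z => featureDeriv_apply hXo hk u z p q⟩ z

lemma inner_dkx (hXo : IsOpen X)
    (hk : ContDiffOn ℝ 4 (fun z : E d × E d => ker H z.1 z.2) (X ×ˢ X))
    (u : X) (p q : Fin d) (f : H) :
    (inner ℝ f (dkx H u p q) : ℝ) = pd2 p q (ext0 f) u := by
  have : dkx H u p q = featureDeriv H p q u := RKHS.ext fun z => by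
    rw [dkx_apply hXo hk, featureDeriv_apply hXo hk]
  rw [this, inner_featureDeriv hXo hk]

lemma dkx_symm (hXo : IsOpen X)
    (hk : ContDiffOn ℝ 4 (fun z : E d × E d => ker H z.1 z.2) (X ×ˢ X))
    (u : X) (p q : Fin d) : dkx H u p q = dkx H u q p := by
  refine RKHS.ext fun z => ?_
  rw [dkx_apply hXo hk, dkx_apply hXo hk]
  refine pd2_symm ?_ p q
  have h1 : ContDiffAt ℝ 4 (fun z : E d × E d => ker H z.1 z.2) ((u : E d), (z : E d)) :=
    hk.contDiffAt ((hXo.prod hXo).mem_nhds ⟨u.2, z.2⟩)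
  exact (h1.comp (f := fun t : E d => (t, (z : E d))) (u : E d) (by fun_prop)).of_le (by norm_num)

lemma d2K_apply (hXo : IsOpen X)
    (hk : ContDiffOn ℝ 4 (fun z : E d × E d => ker H z.1 z.2) (X ×ˢ X))
    {n l : ℕ} (x : Fin n → X) (v : Fin l → X) (p q : Fin d) (i : Fin n) (j : Fin l) :
    d2K H x v p q i j = dkx H (v j) p q (x i) := by
  rw [dkx_apply hXo hk]
  simp only [d2K, Matrix.of_apply]
  congr 1
  funext t
  exact ker_comm H _ _

/-- Pairing with `∂_{pq} k_{v_i}` differentiates at `v_i` the function `u ↦ ∂_{rs} k_{v_j}(u)`,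
which is itself a second derivative of the kernel. -/
lemma d4K_apply (hXo : IsOpen X)
    (hk : ContDiffOn ℝ 4 (fun z : E d × E d => ker H z.1 z.2) (X ×ˢ X))
    {l : ℕ} (v : Fin l → X) (p q r s : Fin d) (i j : Fin l) :
    d4K H v p q r s i j = inner ℝ (dkx H (v i) p q) (dkx H (v j) r s) := by
  rw [real_inner_comm, inner_dkx hXo hk]
  simp only [d4K, Matrix.of_apply]
  refine pd2_congr ?_ p q
  filter_upwards [hXo.mem_nhds (v i).2] with u hu
  lift u to X using hu
  rw [ext0_apply, dkx_apply hXo hk]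
  congr 1
  funext t
  exact ker_comm H _ _

lemma gram_apply {m : ℕ} (a : Fin m → X) (i j : Fin m) :
    gram H a i j = inner ℝ (kx H (a i)) (kx H (a j)) := by
  simp [gram, ker_eq_inner, feature_apply]

end Feature

/-! ### Minimization over the semidefinite cone and `Ω*` -/

section SemidefiniteInf

variable {ι : Type*} [Fintype ι]

lemma frobSq_nonneg (M : Matrix ι ι ℝ) : 0 ≤ frobSq M :=
  Finset.sum_nonneg fun _ _ => Finset.sum_nonneg fun _ _ => sq_nonneg _

lemma frobSq_smul (c : ℝ) (M : Matrix ι ι ℝ) : frobSq (c • M) = c ^ 2 * frobSq M := by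
  simp [frobSq, Finset.mul_sum, mul_pow]

lemma trace_transpose_mul_eq_sum (A B : Matrix ι ι ℝ) :
    (Aᵀ * B).trace = ∑ i, ∑ j, A i j * B i j := by
  simp only [Matrix.trace, Matrix.diag, Matrix.mul_apply, Matrix.transpose_apply]
  exact Finset.sum_comm

lemma frobSq_eq_trace (M : Matrix ι ι ℝ) : frobSq M = (Mᵀ * M).trace := by
  rw [trace_transpose_mul_eq_sum]
  simp [frobSq, sq]

lemma frobSq_smul_sub (c : ℝ) (A B : Matrix ι ι ℝ) :
    frobSq (c • B - A) = c ^ 2 * frobSq B - 2 * c * (Aᵀ * B).trace + frobSq A := by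
  rw [trace_transpose_mul_eq_sum]
  simp only [frobSq, Finset.mul_sum, ← Finset.sum_sub_distrib, ← Finset.sum_add_distrib]
  refine Finset.sum_congr rfl fun i _ => Finset.sum_congr rfl fun j _ => ?_
  simp only [Matrix.sub_apply, Matrix.smul_apply, smul_eq_mul]
  ring

lemma trace_mul_nonneg_of_posSemidef {A B : Matrix ι ι ℝ} (hA : A.PosSemidef)
    (hB : B.PosSemidef) : 0 ≤ (A * B).trace := by
  obtain ⟨m, w, rfl⟩ := Matrix.posSemidef_iff_eq_sum_vecMulVec.1 hA
  rw [Finset.sum_mul, Matrix.trace_sum]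
  refine Finset.sum_nonneg fun i _ => ?_
  rw [Matrix.vecMulVec_mul, Matrix.trace_vecMulVec, dotProduct_comm, ← Matrix.dotProduct_mulVec]
  exact hB.dotProduct_mulVec_nonneg (w i)

/-- The regularised linear functional whose infimum over the semidefinite cone is `-Ω*`. -/
def conePenalty (lam₂ : ℝ) (N B : Matrix ι ι ℝ) : ℝ := (N * B).trace + lam₂ / 2 * frobSq B

lemma conePenalty_zero_nonneg {N B : Matrix ι ι ℝ} (hN : N.PosSemidef) (hB : B.PosSemidef) :
    0 ≤ conePenalty 0 N B := by
  simpa [conePenalty] using trace_mul_nonneg_of_posSemidef hN hB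

lemma exists_conePenalty_lt {N : Matrix ι ι ℝ} (hN : N.IsHermitian) (hN' : ¬ N.PosSemidef)
    (r : ℝ) : ∃ B : Matrix ι ι ℝ, B.PosSemidef ∧ conePenalty 0 N B < r := by
  rw [Matrix.posSemidef_iff_dotProduct_mulVec] at hN'
  push Not at hN'
  obtain ⟨w, hw⟩ := hN' hN
  have hw' : w ⬝ᵥ (N *ᵥ w) < 0 := by simpa using hw
  set c := w ⬝ᵥ (N *ᵥ w) with hc
  have hB : (Matrix.vecMulVec w w).PosSemidef := by
    simpa using Matrix.posSemidef_vecMulVec_self_star w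
  -- On the ray through `w wᵀ` the penalty is linear with slope `c < 0`; this multiple gives the
  -- value `-(|r| + 1) < r`.
  refine ⟨((|r| + 1) / (-c)) • Matrix.vecMulVec w w, hB.smul ?_, ?_⟩
  · have : 0 < -c := by linarith
    positivity
  · have h1 : (N * Matrix.vecMulVec w w).trace = c := by
      rw [Matrix.mul_vecMulVec, Matrix.trace_vecMulVec, dotProduct_comm]
    rw [conePenalty, Matrix.mul_smul, Matrix.trace_smul, h1, smul_eq_mul]
    have : (|r| + 1) / (-c) * c = -(|r| + 1) := by
      rw [div_mul_eq_mul_div, div_eq_iff (by linarith)]; ring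
    rw [this]
    have := neg_abs_le r
    linarith

variable [DecidableEq ι]

/-- In an eigenbasis these are the scalar facts `max(0, -σ) ≥ 0`, `σ + max(0, -σ) ≥ 0` and `σ max(0,
-σ) = -max(0, -σ)²`. -/
lemma symNegPart_spec {N : Matrix ι ι ℝ} (hN : N.IsHermitian) :
    (symNegPart N).PosSemidef ∧ (N + symNegPart N).PosSemidef ∧
      (N * symNegPart N).trace = -frobSq (symNegPart N) := by
  set U : Matrix ι ι ℝ := (hN.eigenvectorUnitary : Matrix ι ι ℝ) with hU
  set σ := hN.eigenvalues with hσ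
  have hUU : Uᵀ * U = 1 := by
    have := hN.eigenvectorUnitary.2
    rw [Matrix.mem_unitaryGroup_iff'] at this
    exact this
  have hNeq : N = U * Matrix.diagonal σ * Uᵀ := by
    have := hN.spectral_theorem
    rw [Unitary.conjStarAlgAut_apply] at this
    exact this
  have hP : symNegPart N = U * Matrix.diagonal (fun i => max 0 (-(σ i))) * Uᵀ := by
    rw [symNegPart, dif_pos hN]
  have hpsd : ∀ τ : ι → ℝ, 0 ≤ τ → (U * Matrix.diagonal τ * Uᵀ).PosSemidef := fun τ hτ =>
    (Matrix.PosSemidef.diagonal hτ).mul_mul_conjTranspose_same U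
  have htr : ∀ τ τ' : ι → ℝ, ((U * Matrix.diagonal τ * Uᵀ) * (U * Matrix.diagonal τ' * Uᵀ)).trace
      = ∑ i, τ i * τ' i := by
    intro τ τ'
    have : (U * Matrix.diagonal τ * Uᵀ) * (U * Matrix.diagonal τ' * Uᵀ)
        = U * (Matrix.diagonal τ * (Uᵀ * U) * Matrix.diagonal τ' * Uᵀ) := by
      simp only [Matrix.mul_assoc]
    rw [this, hUU, Matrix.trace_mul_comm, Matrix.mul_one, Matrix.mul_assoc, hUU, Matrix.mul_one,
      Matrix.diagonal_mul_diagonal, Matrix.trace_diagonal]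
  have hPpsd : (symNegPart N).PosSemidef := hP ▸ hpsd _ fun i => le_max_left _ _
  refine ⟨hPpsd, ?_, ?_⟩
  · have : N + symNegPart N = U * Matrix.diagonal (fun i => σ i + max 0 (-(σ i))) * Uᵀ := by
      rw [hP, ← Matrix.diagonal_add, Matrix.mul_add, Matrix.add_mul, ← hNeq]
    rw [this]
    refine hpsd _ fun i => ?_
    change 0 ≤ σ i + max 0 (-(σ i))
    linarith [le_max_right 0 (-(σ i))]
  · have hsym : (symNegPart N)ᵀ = symNegPart N := hPpsd.isHermitian
    rw [frobSq_eq_trace, hsym]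
    conv_lhs => rw [hP]; enter [1, 1]; rw [hNeq]
    rw [hP, htr, htr, ← Finset.sum_neg_distrib]
    refine Finset.sum_congr rfl fun i _ => ?_
    rcases le_total (σ i) 0 with h | h
    · rw [max_eq_right (by linarith)]; ring
    · rw [max_eq_left (by linarith)]; ring

/-- Since `N + N₋ ⪰ 0`, the trace of `N B` is at least minus that of `N₋ B`; the rest is `‖λ₂ B -
N₋‖² ≥ 0`. Equality at `B = N₋ / λ₂` is `conePenalty_symNegPart`. -/
lemma conePenalty_lower_bound {lam₂ : ℝ} (h : 0 < lam₂) {N B : Matrix ι ι ℝ} (hN : N.IsHermitian)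
    (hB : B.PosSemidef) : -(1 / (2 * lam₂) * frobSq (symNegPart N)) ≤ conePenalty lam₂ N B := by
  obtain ⟨h1, h2, -⟩ := symNegPart_spec hN
  have h3 := trace_mul_nonneg_of_posSemidef h2 hB
  rw [Matrix.add_mul, Matrix.trace_add] at h3
  have h4 := frobSq_nonneg (lam₂ • B - symNegPart N)
  have hsym : (symNegPart N)ᵀ = symNegPart N := h1.isHermitian
  rw [frobSq_smul_sub, hsym] at h4
  have h5 : 0 ≤ 1 / (2 * lam₂) * (lam₂ ^ 2 * frobSq B - 2 * lam₂ * (symNegPart N * B).trace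
    + frobSq (symNegPart N)) := by positivity
  have h6 : 1 / (2 * lam₂) * (lam₂ ^ 2 * frobSq B - 2 * lam₂ * (symNegPart N * B).trace
    + frobSq (symNegPart N)) = lam₂ / 2 * frobSq B - (symNegPart N * B).trace
      + 1 / (2 * lam₂) * frobSq (symNegPart N) := by
    field_simp
  rw [conePenalty]
  linarith

lemma conePenalty_symNegPart {lam₂ : ℝ} (h : 0 < lam₂) {N : Matrix ι ι ℝ} (hN : N.IsHermitian) :
    conePenalty lam₂ N (lam₂⁻¹ • symNegPart N) = -(1 / (2 * lam₂) * frobSq (symNegPart N)) := by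
  rw [conePenalty, Matrix.mul_smul, Matrix.trace_smul, (symNegPart_spec hN).2.2, frobSq_smul,
    smul_eq_mul]
  field_simp
  ring

/-- Minimising a sum of a function with a minimum and the penalty over the semidefinite cone. -/
lemma iInf_add_conePenalty {Y : Type*} {lam₁ lam₂ : ℝ} (hlam : 0 ≤ lam₂) {M : Matrix ι ι ℝ}
    (hM : M.IsHermitian) (h : Y → ℝ) (f₀ : Y) (hf₀ : ∀ f, h f₀ ≤ h f) :
    (⨅ (f : Y) (B : Matrix ι ι ℝ) (_ : B.PosSemidef),
      ((h f + conePenalty lam₂ (M + lam₁ • (1 : Matrix ι ι ℝ)) B : ℝ) : EReal))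
      = -(((-(h f₀) : ℝ) : EReal) + OmegaStar lam₁ lam₂ M) := by
  have hN : (M + lam₁ • (1 : Matrix ι ι ℝ)).IsHermitian := by
    refine hM.add ?_
    rw [Matrix.IsHermitian, Matrix.conjTranspose_smul]
    simp
  set N := M + lam₁ • (1 : Matrix ι ι ℝ) with hNdef
  by_cases h2 : 0 < lam₂
  · rw [OmegaStar, if_pos h2, ← hNdef, ← EReal.coe_add, ← EReal.coe_neg]
    refine le_antisymm ?_ ?_
    · refine (iInf_le _ f₀).trans ((iInf_le _ (lam₂⁻¹ • symNegPart N)).trans ((iInf_le _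
        ((symNegPart_spec hN).1.smul (by positivity))).trans ?_))
      rw [conePenalty_symNegPart h2 hN]
      exact EReal.coe_le_coe_iff.2 (by linarith)
    · refine le_iInf fun f => le_iInf fun B => le_iInf fun hB => EReal.coe_le_coe_iff.2 ?_
      linarith [hf₀ f, conePenalty_lower_bound h2 hN hB]
  · obtain rfl : lam₂ = 0 := le_antisymm (not_lt.1 h2) hlam
    rw [OmegaStar, if_neg h2, ← hNdef]
    split_ifs with hP
    · rw [add_zero, ← EReal.coe_neg, neg_neg]
      refine le_antisymm ?_ ?_
      · refine (iInf_le _ f₀).trans ((iInf_le _ 0).trans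
          ((iInf_le _ Matrix.PosSemidef.zero).trans ?_))
        simp [conePenalty]
      · refine le_iInf fun f => le_iInf fun B => le_iInf fun hB => EReal.coe_le_coe_iff.2 ?_
        linarith [hf₀ f, conePenalty_zero_nonneg hP hB]
    · rw [EReal.coe_add_top, EReal.neg_top, EReal.eq_bot_iff_forall_lt]
      intro r
      obtain ⟨B, hB, hBr⟩ := exists_conePenalty_lt hN hP (r - h f₀)
      refine lt_of_le_of_lt ((iInf_le _ f₀).trans ((iInf_le _ B).trans (iInf_le _ hB))) ?_
      exact EReal.coe_lt_coe_iff.2 (by linarith)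

end SemidefiniteInf

/-! ### Ridge regression with a linear perturbation -/

section Ridge

variable {d : ℕ} {X : Set (E d)}
variable {H : Type*} [NormedAddCommGroup H] [InnerProductSpace ℝ H] [CompleteSpace H]
variable [RKHS ℝ H X ℝ]
variable {n : ℕ}

lemma gram_posSemidef (x : Fin n → X) : (gram H x).PosSemidef := by
  refine Matrix.PosSemidef.of_dotProduct_mulVec_nonneg ?_ fun w => ?_
  · ext i j
    simp only [Matrix.conjTranspose_apply, gram_apply, star_trivial]
    exact real_inner_comm _ _
  · have : star w ⬝ᵥ (gram H x *ᵥ w)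
        = inner ℝ (∑ i, w i • kx H (x i)) (∑ i, w i • kx H (x i)) := by
      simp only [dotProduct, Matrix.mulVec, sum_inner, inner_sum, inner_smul_left,
        inner_smul_right, gram_apply, Finset.mul_sum, star_trivial, RCLike.conj_to_real]
      refine Finset.sum_congr rfl fun i _ => Finset.sum_congr rfl fun j _ => ?_
      linear_combination (w i * w j) * real_inner_comm (kx H (x j)) (kx H (x i))
    rw [this]
    exact real_inner_self_nonneg

lemma regularized_gram_posDef (x : Fin n → X) {ρ : ℝ} (hρ : 0 < ρ) :
    ((1 / (n : ℝ)) • gram H x + ρ • (1 : Matrix (Fin n) (Fin n) ℝ)).PosDef :=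
  Matrix.PosDef.posSemidef_add ((gram_posSemidef x).smul (by positivity))
    (Matrix.PosDef.one.smul hρ)

lemma regularized_gram_mul_W (x : Fin n → X) {ρ : ℝ} (hρ : 0 < ρ) :
    ((1 / (n : ℝ)) • gram H x + ρ • (1 : Matrix (Fin n) (Fin n) ℝ)) * W H x ρ = 1 :=
  Matrix.mul_nonsing_inv _ ((Matrix.isUnit_iff_isUnit_det _).1
    (regularized_gram_posDef x hρ).isUnit)

lemma gram_mul_W (x : Fin n → X) {ρ : ℝ} (hρ : 0 < ρ) :
    (1 / (n : ℝ)) • (gram H x * W H x ρ) = 1 - ρ • W H x ρ := by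
  have := regularized_gram_mul_W (H := H) x hρ
  rw [Matrix.add_mul, Matrix.smul_mul, Matrix.smul_mul, Matrix.one_mul] at this
  exact eq_sub_of_add_eq this

lemma W_transpose (x : Fin n → X) {ρ : ℝ} (hρ : 0 < ρ) : (W H x ρ)ᵀ = W H x ρ :=
  (regularized_gram_posDef x hρ).inv.isHermitian

lemma W_dotProduct_comm (x : Fin n → X) {ρ : ℝ} (hρ : 0 < ρ) (a b : Fin n → ℝ) :
    a ⬝ᵥ (W H x ρ *ᵥ b) = b ⬝ᵥ (W H x ρ *ᵥ a) := by
  rw [dotProduct_comm, ← Matrix.vecMul_transpose, W_transpose x hρ, ← Matrix.dotProduct_mulVec]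

/-- The least squares functional with a ridge penalty and a linear perturbation. -/
def ridgeObj (x : Fin n → X) (y : Fin n → ℝ) (ρ : ℝ) (g f : H) : ℝ :=
  1 / (n : ℝ) * ∑ i, (y i - f (x i)) ^ 2 + ρ * ‖f‖ ^ 2 - inner ℝ f g

/-- The coefficients of the ridge minimizer in the kernel sections. -/
def ridgeCoeff (x : Fin n → X) (y : Fin n → ℝ) (ρ : ℝ) (g : H) : Fin n → ℝ :=
  (1 / (n : ℝ)) • (W H x ρ *ᵥ (y - (1 / (2 * ρ)) • fun i => g (x i)))

/-- The minimizer of `ridgeObj`. -/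
def ridgeMin (x : Fin n → X) (y : Fin n → ℝ) (ρ : ℝ) (g : H) : H :=
  ∑ i, ridgeCoeff x y ρ g i • kx H (x i) + (1 / (2 * ρ)) • g

lemma inner_ridgeMin (x : Fin n → X) (y : Fin n → ℝ) (ρ : ℝ) (g e : H) :
    (inner ℝ (ridgeMin x y ρ g) e : ℝ)
      = ∑ i, ridgeCoeff x y ρ g i * e (x i) + 1 / (2 * ρ) * inner ℝ e g := by
  simp only [ridgeMin, inner_add_left, sum_inner, real_inner_smul_left]
  congr 1
  · refine Finset.sum_congr rfl fun i _ => ?_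
    rw [real_inner_comm, inner_kx]
  · rw [real_inner_comm]

/-- This is the stationarity condition read off coefficientwise; it follows from `K W / n = I - ρ
W`. -/
lemma ridgeMin_residual (hn : 1 ≤ n) (x : Fin n → X) (y : Fin n → ℝ) {ρ : ℝ} (hρ : 0 < ρ) (g : H)
    (i : Fin n) :
    y i - ridgeMin x y ρ g (x i) = n * ρ * ridgeCoeff x y ρ g i := by
  have hn' : (n : ℝ) ≠ 0 := by positivity
  set z : Fin n → ℝ := y - (1 / (2 * ρ)) • fun i => g (x i) with hz
  have h1 : (gram H x *ᵥ ridgeCoeff x y ρ g) i = z i - ρ * (W H x ρ *ᵥ z) i := by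
    rw [ridgeCoeff, ← hz, Matrix.mulVec_smul, Matrix.mulVec_mulVec, ← Matrix.smul_mulVec,
      gram_mul_W x hρ, Matrix.sub_mulVec, Matrix.one_mulVec, Matrix.smul_mulVec]
    simp
  have h2 : ridgeMin x y ρ g (x i)
      = (gram H x *ᵥ ridgeCoeff x y ρ g) i + 1 / (2 * ρ) * g (x i) := by
    rw [← inner_kx, inner_ridgeMin, real_inner_comm, inner_kx]
    congr 1
    simp only [Matrix.mulVec, dotProduct]
    refine Finset.sum_congr rfl fun j _ => ?_
    rw [gram_apply, inner_kx, mul_comm]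
  have h3 : ridgeCoeff x y ρ g i = 1 / n * (W H x ρ *ᵥ z) i := by simp [ridgeCoeff, hz]
  rw [h2, h1, h3, hz]
  simp only [Pi.sub_apply, Pi.smul_apply, smul_eq_mul]
  field_simp
  ring

/-- The objective is quadratic, so its expansion about a stationary point is exact and has no linear
term. The last summand later forces uniqueness of the primal `f`. -/
lemma ridgeObj_eq (hn : 1 ≤ n) (x : Fin n → X) (y : Fin n → ℝ) {ρ : ℝ} (hρ : 0 < ρ) (g f : H) :
    ridgeObj x y ρ g f = ridgeObj x y ρ g (ridgeMin x y ρ g)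
      + 1 / (n : ℝ) * ∑ i, (f (x i) - ridgeMin x y ρ g (x i)) ^ 2
      + ρ * ‖f - ridgeMin x y ρ g‖ ^ 2 := by
  have hn' : (n : ℝ) ≠ 0 := by positivity
  set f₀ := ridgeMin x y ρ g with hf₀
  obtain ⟨e, rfl⟩ : ∃ e, f = f₀ + e := ⟨f - f₀, by abel⟩
  have h1 : ∀ i, (y i - (f₀ + e) (x i)) ^ 2 = (y i - f₀ (x i)) ^ 2
      - 2 * (n * ρ) * (ridgeCoeff x y ρ g i * e (x i)) + (e (x i)) ^ 2 := by
    intro i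
    have := ridgeMin_residual hn x y hρ g i
    rw [← hf₀] at this
    rw [RKHS.coe_add, Pi.add_apply]
    linear_combination (-2 * e (x i)) * this
  have h2 : ∀ i, ((f₀ + e) (x i) - f₀ (x i)) ^ 2 = (e (x i)) ^ 2 := by
    intro i
    rw [RKHS.coe_add, Pi.add_apply]
    ring
  have h3 := inner_ridgeMin x y ρ g e
  rw [← hf₀] at h3
  simp only [ridgeObj, h1, h2, Finset.sum_add_distrib, Finset.sum_sub_distrib, ← Finset.mul_sum,
    add_sub_cancel_left]
  rw [norm_add_sq_real, inner_add_left, h3]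
  field_simp
  ring

lemma ridgeObj_ridgeMin_le (hn : 1 ≤ n) (x : Fin n → X) (y : Fin n → ℝ) {ρ : ℝ} (hρ : 0 < ρ)
    (g f : H) : ridgeObj x y ρ g (ridgeMin x y ρ g) ≤ ridgeObj x y ρ g f := by
  rw [ridgeObj_eq hn x y hρ g f, add_assoc]
  have : 0 ≤ ∑ i, (f (x i) - ridgeMin x y ρ g (x i)) ^ 2 :=
    Finset.sum_nonneg fun _ _ => sq_nonneg _
  have : 0 ≤ 1 / (n : ℝ) * ∑ i, (f (x i) - ridgeMin x y ρ g (x i)) ^ 2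
      + ρ * ‖f - ridgeMin x y ρ g‖ ^ 2 := by positivity
  linarith

lemma ridgeObj_ridgeMin (hn : 1 ≤ n) (x : Fin n → X) (y : Fin n → ℝ) {ρ : ℝ} (hρ : 0 < ρ)
    (g : H) : ridgeObj x y ρ g (ridgeMin x y ρ g)
      = ρ / n * (y ⬝ᵥ (W H x ρ *ᵥ y)) - 1 / n * (y ⬝ᵥ (W H x ρ *ᵥ fun i => g (x i)))
        + 1 / (4 * n * ρ) * ((fun i => g (x i)) ⬝ᵥ (W H x ρ *ᵥ fun i => g (x i)))
        - 1 / (4 * ρ) * inner ℝ g g := by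
  have hn' : (n : ℝ) ≠ 0 := by positivity
  set u : Fin n → ℝ := fun i => g (x i) with hu
  set a := ridgeCoeff x y ρ g with ha
  have hsum : ∀ c : Fin n → ℝ, ∑ i, a i * c i
      = 1 / n * (c ⬝ᵥ (W H x ρ *ᵥ y)) - 1 / (2 * n * ρ) * (c ⬝ᵥ (W H x ρ *ᵥ u)) := by
    intro c
    have h0 : ∑ i, a i * c i = c ⬝ᵥ a := by
      rw [dotProduct_comm]; rfl
    rw [h0, ha, ridgeCoeff, ← hu, dotProduct_smul, Matrix.mulVec_sub, Matrix.mulVec_smul,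
      dotProduct_sub, dotProduct_smul, smul_eq_mul, smul_eq_mul]
    field_simp
  have h1 := inner_ridgeMin x y ρ g (ridgeMin x y ρ g)
  have h2 := inner_ridgeMin x y ρ g g
  -- In this form the sum of `a i` times the fitted values cancels against the same sum in `ρ
  -- ‖f₀‖²`, `f₀` being the minimizer; only pairings with `y` and `g` remain.
  have h3 : ∑ i, (y i - ridgeMin x y ρ g (x i)) ^ 2
      = n * ρ * (∑ i, a i * y i - ∑ i, a i * ridgeMin x y ρ g (x i)) := by
    rw [← Finset.sum_sub_distrib, Finset.mul_sum]
    refine Finset.sum_congr rfl fun i _ => ?_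
    have := ridgeMin_residual hn x y hρ g i
    rw [← ha] at this
    linear_combination (y i - ridgeMin x y ρ g (x i)) * this
  rw [real_inner_self_eq_norm_sq, ← ha] at h1
  rw [← ha, hsum u] at h2
  have h4 := hsum y
  have h5 := W_dotProduct_comm (H := H) x hρ u y
  rw [ridgeObj, h3, h1, h4, h2, h5]
  field_simp
  ring

end Ridge

/-! ### Identification of the dual objective and of `fStar` -/

section DualObjective

variable {d : ℕ} {X : Set (E d)}
variable (H : Type*) [NormedAddCommGroup H] [InnerProductSpace ℝ H] [CompleteSpace H]
variable [RKHS ℝ H X ℝ]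
variable {n l : ℕ}

/-- The element `∑_{j,p,q} Γ^{(j)}_{pq} ∂_{pq} k_{v_j}`. -/
def multiplierElt (v : Fin l → X) (Γ : Fin l → Matrix (Fin d) (Fin d) ℝ) : H :=
  ∑ j, ∑ p, ∑ q, Γ j p q • dkx H (v j) p q

lemma multiplierElt_eq (v : Fin l → X) (Γ : Fin l → Matrix (Fin d) (Fin d) ℝ) :
    multiplierElt H v Γ = ∑ p, ∑ q, ∑ j, slice Γ p q j • dkx H (v j) p q := by
  rw [multiplierElt, Finset.sum_comm]
  exact Finset.sum_congr rfl fun p _ => Finset.sum_comm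

variable {H}

lemma multiplierElt_apply (hXo : IsOpen X)
    (hk : ContDiffOn ℝ 4 (fun z : E d × E d => ker H z.1 z.2) (X ×ˢ X))
    (x : Fin n → X) (v : Fin l → X) (Γ : Fin l → Matrix (Fin d) (Fin d) ℝ) :
    (fun i => multiplierElt H v Γ (x i)) = ∑ p, ∑ q, d2K H x v p q *ᵥ slice Γ p q := by
  funext i
  rw [← inner_kx, multiplierElt_eq]
  simp only [sum_inner, real_inner_smul_left]
  simp only [inner_kx, Finset.sum_apply, Matrix.mulVec, dotProduct, d2K_apply hXo hk]
  refine Finset.sum_congr rfl fun p _ => Finset.sum_congr rfl fun q _ =>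
    Finset.sum_congr rfl fun j _ => mul_comm _ _

lemma multiplierElt_inner_self (hXo : IsOpen X)
    (hk : ContDiffOn ℝ 4 (fun z : E d × E d => ker H z.1 z.2) (X ×ˢ X))
    (v : Fin l → X) (Γ : Fin l → Matrix (Fin d) (Fin d) ℝ) :
    (inner ℝ (multiplierElt H v Γ) (multiplierElt H v Γ) : ℝ)
      = ∑ p, ∑ q, ∑ r, ∑ s, slice Γ p q ⬝ᵥ (d4K H v p q r s *ᵥ slice Γ r s) := by
  rw [multiplierElt_eq, sum_inner]
  refine Finset.sum_congr rfl fun p _ => ?_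
  rw [sum_inner]
  refine Finset.sum_congr rfl fun q _ => ?_
  rw [inner_sum]
  refine Finset.sum_congr rfl fun r _ => ?_
  rw [inner_sum]
  refine Finset.sum_congr rfl fun s _ => ?_
  simp only [sum_inner, inner_sum, real_inner_smul_left, real_inner_smul_right, dotProduct,
    Matrix.mulVec, d4K_apply hXo hk, Finset.mul_sum]
  rw [Finset.sum_comm]
  refine Finset.sum_congr rfl fun i _ => Finset.sum_congr rfl fun j _ => ?_
  ring

lemma ridgeObj_ridgeMin_eq_neg_dualQuad (hXo : IsOpen X)
    (hk : ContDiffOn ℝ 4 (fun z : E d × E d => ker H z.1 z.2) (X ×ˢ X))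
    (hn : 1 ≤ n) (x : Fin n → X) (y : Fin n → ℝ) (v : Fin l → X) {ρ : ℝ} (hρ : 0 < ρ)
    (Γ : Fin l → Matrix (Fin d) (Fin d) ℝ) :
    ridgeObj x y ρ (multiplierElt H v Γ) (ridgeMin x y ρ (multiplierElt H v Γ))
      = -dualQuad H x y v ρ Γ := by
  have hn' : (n : ℝ) ≠ 0 := by positivity
  have hWW : ∑ p, ∑ q, ∑ r, ∑ s,
      slice Γ p q ⬝ᵥ (((d2K H x v p q)ᵀ * W H x ρ * d2K H x v r s) *ᵥ slice Γ r s)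
      = (∑ p, ∑ q, d2K H x v p q *ᵥ slice Γ p q) ⬝ᵥ
        (W H x ρ *ᵥ ∑ p, ∑ q, d2K H x v p q *ᵥ slice Γ p q) := by
    simp only [sum_dotProduct, Matrix.mulVec_sum, dotProduct_sum]
    refine Finset.sum_congr rfl fun p _ => Finset.sum_congr rfl fun q _ =>
      Finset.sum_congr rfl fun r _ => Finset.sum_congr rfl fun s _ => ?_
    rw [← Matrix.mulVec_mulVec, ← Matrix.mulVec_mulVec, Matrix.dotProduct_mulVec,
      Matrix.vecMul_transpose, W_dotProduct_comm x hρ]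
  rw [ridgeObj_ridgeMin hn x y hρ, dualQuad, hWW, ← multiplierElt_inner_self hXo hk,
    ← multiplierElt_apply hXo hk, gram_mul_W x hρ]
  set u : Fin n → ℝ := fun i => multiplierElt H v Γ (x i)
  -- After substituting `K W / n = I - ρ W`, both matrices in the dual objective are multiples of
  -- `W`.
  have e1 : (1 + ρ • W H x ρ - (1 - ρ • W H x ρ)) = (2 * ρ) • W H x ρ := by
    rw [two_mul, add_smul]; abel
  have e2 : (1 - ρ • W H x ρ - 1) = (-ρ) • W H x ρ := by
    rw [neg_smul]; abel
  rw [e1, e2, Matrix.smul_mulVec, Matrix.smul_mulVec, dotProduct_smul, dotProduct_smul,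
    smul_eq_mul, smul_eq_mul]
  field_simp
  ring

lemma fStar_eq_ridgeMin (hXo : IsOpen X)
    (hk : ContDiffOn ℝ 4 (fun z : E d × E d => ker H z.1 z.2) (X ×ˢ X))
    (x : Fin n → X) (y : Fin n → ℝ) (v : Fin l → X) (ρ : ℝ)
    (Γ : Fin l → Matrix (Fin d) (Fin d) ℝ) :
    fStar H x y v ρ Γ = ridgeMin x y ρ (multiplierElt H v Γ) := by
  rw [fStar, ridgeMin]
  congr 1
  refine Finset.sum_congr rfl fun i _ => ?_
  congr 1
  rw [ridgeCoeff, multiplierElt_apply hXo hk, Matrix.mulVec_sub, Matrix.mulVec_smul]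
  simp only [alpha, delta, Matrix.mulVec_sum, Matrix.mulVec_mulVec, Pi.smul_apply, Pi.sub_apply,
    Finset.sum_apply, smul_eq_mul, ← Finset.mul_sum]
  -- In the degenerate cases both sides agree because division by zero gives zero.
  by_cases hn : (n : ℝ) = 0
  · simp [hn]
  by_cases hρ : ρ = 0
  · simp [hρ]
  field_simp
  ring

end DualObjective

/-! ### Lagrange multipliers from the Riesz extension theorem -/

section Multiplier

variable {Y T : Type*} [AddCommGroup Y] [Module ℝ Y] [AddCommGroup T] [Module ℝ T]

/-- Existence of a Lagrange multiplier for a convex problem with linear equality constraints, under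
a constraint qualification of Slater type. -/
theorem exists_lagrange_multiplier {S : Submodule ℝ Y} {C : Set Y} (hCS : C ⊆ S) {φ : Y → ℝ}
    (hφ : ConvexOn ℝ C φ) (c : Y →ₗ[ℝ] T)
    (hslater : ∀ z ∈ S, ∃ ε : ℝ, 0 < ε ∧ ∃ y ∈ C, c y = ε • c z) {P : ℝ}
    (hP : ∀ y ∈ C, c y = 0 → P ≤ φ y) :
    ∃ Λ : T →ₗ[ℝ] ℝ, ∀ y ∈ C, P ≤ φ y + Λ (c y) := by
  let W : Submodule ℝ T := S.map c
  -- The cone generated by the pairs `(c y, t)` with `t ≥ φ y - P`, together with the ray `{0} × [0,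
  -- ∞)`.
  let K : PointedCone ℝ (W × ℝ) :=
    { carrier := {z | ∃ a : ℝ, 0 ≤ a ∧ ∃ y ∈ C, (z.1 : T) = a • c y ∧ a * (φ y - P) ≤ z.2}
      zero_mem' := by
        obtain ⟨-, -, y, hy, -⟩ := hslater 0 S.zero_mem
        exact ⟨0, le_rfl, y, hy, by simp, by simp⟩
      add_mem' := by
        rintro z w ⟨a, ha, y, hy, hz1, hz2⟩ ⟨b, hb, y', hy', hw1, hw2⟩
        rcases (add_nonneg ha hb).eq_or_lt with h0 | h0
        · obtain rfl : a = 0 := by linarith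
          obtain rfl : b = 0 := by linarith
          refine ⟨0, le_rfl, y, hy, ?_, ?_⟩
          · simp [hz1, hw1]
          · simp only [zero_mul, Prod.snd_add] at *
            linarith
        · have hab : a / (a + b) + b / (a + b) = 1 := by field_simp
          have ha' : 0 ≤ a / (a + b) := by positivity
          have hb' : 0 ≤ b / (a + b) := by positivity
          refine ⟨a + b, h0.le, (a / (a + b)) • y + (b / (a + b)) • y',
            hφ.1 hy hy' ha' hb' hab, ?_, ?_⟩
          · rw [Prod.fst_add, Submodule.coe_add, hz1, hw1, map_add, map_smul, map_smul, smul_add,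
              smul_smul, smul_smul, mul_div_cancel₀ _ h0.ne', mul_div_cancel₀ _ h0.ne']
          · have h1 := mul_le_mul_of_nonneg_left (hφ.2 hy hy' ha' hb' hab) h0.le
            have h2 : (a + b) * (a / (a + b) * φ y + b / (a + b) * φ y') = a * φ y + b * φ y' := by
              field_simp
            rw [smul_eq_mul, smul_eq_mul, h2] at h1
            rw [Prod.snd_add]
            linarith
      smul_mem' := by
        rintro ⟨t, ht⟩ z ⟨a, ha, y, hy, hz1, hz2⟩
        refine ⟨t * a, mul_nonneg ht ha, y, hy, ?_, ?_⟩
        · change ((t • z.1 : W) : T) = _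
          rw [Submodule.coe_smul, hz1, smul_smul]
        · change _ ≤ t * z.2
          rw [mul_assoc]
          exact mul_le_mul_of_nonneg_left hz2 ht }
  -- The functional `(0, t) ↦ t` on the vertical axis: it is nonnegative on the cone because `P` is
  -- a lower bound on feasible values. The Slater condition says that every vector of `W × ℝ` can be
  -- moved into the cone along the axis, as the extension theorem requires.
  let F : W × ℝ →ₗ.[ℝ] ℝ :=
    ⟨LinearMap.range (LinearMap.inr ℝ W ℝ), (LinearMap.snd ℝ W ℝ).comp (Submodule.subtype _)⟩
  obtain ⟨g, hg1, hg2⟩ := riesz_extension K F (by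
    rintro ⟨_, ⟨t, rfl⟩⟩ ⟨a, ha, y, hy, h1, h2⟩
    change 0 ≤ t
    replace h2 : a * (φ y - P) ≤ t := h2
    rcases ha.eq_or_lt with rfl | ha'
    · simpa using h2
    · have h3 : c y = 0 := by
        have : a • c y = 0 := h1.symm
        exact (smul_eq_zero.1 this).resolve_left ha'.ne'
      have := mul_nonneg ha (sub_nonneg.2 (hP y hy h3))
      linarith) (by
    rintro ⟨⟨_, ⟨z, hz, rfl⟩⟩, τ⟩
    obtain ⟨ε, hε, y, hy, hcy⟩ := hslater z hz
    refine ⟨⟨LinearMap.inr ℝ W ℝ (ε⁻¹ * (φ y - P) - τ), ⟨_, rfl⟩⟩, ε⁻¹, by positivity, y, hy, ?_, ?_⟩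
    · rw [hcy, smul_smul, inv_mul_cancel₀ hε.ne']
      simp
    · simp)
  -- The extension has the form `(w, t) ↦ Λ w + t`, with `Λ` so far defined only on `W`.
  obtain ⟨Λ, hΛ⟩ := LinearMap.exists_extend (g.comp (LinearMap.inl ℝ W ℝ))
  refine ⟨Λ, fun y hy => ?_⟩
  have hw : c y ∈ W := ⟨y, hCS hy, rfl⟩
  have h1 : 0 ≤ g (⟨c y, hw⟩, φ y - P) := hg2 _ ⟨1, zero_le_one, y, hy, by simp, by simp⟩
  have h2 : g (0, φ y - P) = φ y - P := hg1 ⟨LinearMap.inr ℝ W ℝ (φ y - P), ⟨_, rfl⟩⟩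
  have h3 : Λ (c y) = g (⟨c y, hw⟩, 0) := LinearMap.congr_fun hΛ ⟨c y, hw⟩
  have h4 : g (⟨c y, hw⟩, φ y - P) = g (⟨c y, hw⟩, 0) + g (0, φ y - P) := by
    rw [← map_add]; simp
  linarith

/-- Linear functionals on tuples of matrices are given by coefficients. -/
lemma exists_coeff_of_linearMap {l d : ℕ} (Λ : (Fin l → Matrix (Fin d) (Fin d) ℝ) →ₗ[ℝ] ℝ) :
    ∃ A : Fin l → Matrix (Fin d) (Fin d) ℝ, ∀ u, Λ u = ∑ j, ∑ p, ∑ q, A j p q * u j p q := by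
  refine ⟨fun j => Matrix.of fun p q => Λ (Pi.single j (Matrix.single p q 1)), fun u => ?_⟩
  conv_lhs => rw [← Finset.univ_sum_single u]
  rw [map_sum]
  refine Finset.sum_congr rfl fun j _ => ?_
  have : (LinearMap.single ℝ (fun _ : Fin l => Matrix (Fin d) (Fin d) ℝ) j) (u j)
      = Pi.single j (u j) := rfl
  rw [← this]
  conv_lhs => rw [Matrix.matrix_eq_sum_single (u j)]
  rw [map_sum, map_sum]
  refine Finset.sum_congr rfl fun p _ => ?_
  rw [map_sum, map_sum]
  refine Finset.sum_congr rfl fun q _ => ?_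
  have h2 : Matrix.single p q (u j p q) = u j p q • Matrix.single p q (1 : ℝ) := by
    rw [Matrix.smul_single, smul_eq_mul, mul_one]
  rw [h2, map_smul, map_smul, smul_eq_mul, mul_comm]
  rfl

end Multiplier

/-! ### Smooth functions with prescribed Hessians -/

section Bump

variable {d : ℕ}

lemma exists_contDiff_separating (F : Finset (E d)) (a : E d) (s : ℕ) :
    ∃ χ : E d → ℝ, ContDiff ℝ s χ ∧ χ =ᶠ[𝓝 a] 1 ∧ ∀ b ∈ F, b ≠ a → χ =ᶠ[𝓝 b] 0 := by
  have h1 : ((F.erase a : Finset (E d)) : Set (E d))ᶜ ∈ 𝓝 a :=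
    (F.erase a).finite_toSet.isClosed.isOpen_compl.mem_nhds (by simp)
  obtain ⟨r, hr, hball⟩ := Metric.mem_nhds_iff.1 h1
  let χ : ContDiffBump a := ⟨r / 4, r / 2, by positivity, by linarith⟩
  refine ⟨χ, χ.contDiff, χ.eventuallyEq_one, fun b hb hba => ?_⟩
  have h2 : b ∉ Metric.closedBall a (r / 2) := fun h => by
    have h3 : b ∈ Metric.ball a r := Metric.closedBall_subset_ball (by linarith) h
    exact hball h3 (by simp [hb, hba])
  filter_upwards [Metric.isClosed_closedBall.isOpen_compl.mem_nhds h2] with z hz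
  exact χ.zero_of_le_dist (not_le.1 fun h => hz (Metric.mem_closedBall.2 h)).le

lemma pd2_mul_norm_sq (c : ℝ) (p q : Fin d) (u : E d) :
    pd2 p q (fun z => c * ‖z‖ ^ 2) u = if p = q then 2 * c else 0 := by
  have h1 : pd q (fun z : E d => c * ‖z‖ ^ 2) = fun z => 2 * c * z q := by
    funext z
    have := ((hasStrictFDerivAt_norm_sq z).hasFDerivAt.const_mul c).hasLineDerivAt
      (EuclideanSpace.single q (1 : ℝ))
    refine this.lineDeriv.trans ?_
    have h := EuclideanSpace.inner_single_right (𝕜 := ℝ) q (1 : ℝ) z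
    simp only [FunLike.coe_smul, Pi.smul_apply, innerSL_apply_apply, h]
    simp
    ring
  have h2 : HasFDerivAt (fun z : E d => 2 * c * z q) ((2 * c) • EuclideanSpace.proj (𝕜 := ℝ) q) u :=
    (EuclideanSpace.proj (𝕜 := ℝ) q : E d →L[ℝ] ℝ).hasFDerivAt.const_mul (2 * c)
  rw [pd2, h1]
  refine (h2.hasLineDerivAt (EuclideanSpace.single p 1)).lineDeriv.trans ?_
  simp [eq_comm]

/-- There is a smooth function with prescribed scalar Hessians at finitely many points. -/
lemma exists_contDiff_pd2 (F : Finset (E d)) (κ : E d → ℝ) (s : ℕ) :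
    ∃ g : E d → ℝ, ContDiff ℝ s g ∧
      ∀ a ∈ F, ∀ p q, pd2 p q g a = if p = q then κ a else 0 := by
  choose χ hχ hχ1 hχ0 using fun a => exists_contDiff_separating F a s
  -- Near a point `a` of `F` its own bump is `1` and the others vanish, leaving `κ a / 2 * ‖z‖²`,
  -- whose Hessian is `κ a` times the identity.
  refine ⟨fun z => ∑ a ∈ F, χ a z * (κ a / 2 * ‖z‖ ^ 2), ?_, fun a ha p q => ?_⟩
  · exact ContDiff.sum fun a _ => (hχ a).mul (contDiff_const.mul (contDiff_norm_sq ℝ))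
  · have h1 : (fun z => ∑ b ∈ F, χ b z * (κ b / 2 * ‖z‖ ^ 2)) =ᶠ[𝓝 a]
        fun z => κ a / 2 * ‖z‖ ^ 2 := by
      have h2 : ∀ᶠ z in 𝓝 a, ∀ b ∈ F, b ≠ a → χ b z = 0 := by
        refine (Filter.eventually_all_finset F).2 fun b hb => ?_
        by_cases hba : b = a
        · exact Eventually.of_forall fun z h => absurd hba h
        · filter_upwards [hχ0 b a ha (Ne.symm hba)] with z hz _ using hz
      filter_upwards [hχ1 a, h2] with z hz1 hz2
      rw [Finset.sum_eq_single_of_mem a ha fun b hb hba => by rw [hz2 b hb hba, zero_mul], hz1]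
      simp
    rw [pd2_congr h1, pd2_mul_norm_sq]
    split_ifs <;> ring

end Bump

/-! ### Bounds and topology of the semidefinite cone -/

section PosSemidef

variable {ι : Type*} [Fintype ι]

/-- For a rank one matrix `w wᵀ` this is `|w_i w_j| ≤ (w_i² + w_j²) / 2 ≤ ‖w‖²`; the general case is
a sum of such matrices. -/
lemma abs_entry_le_trace {B : Matrix ι ι ℝ} (hB : B.PosSemidef) (i j : ι) :
    |B i j| ≤ B.trace := by
  obtain ⟨m, w, rfl⟩ := Matrix.posSemidef_iff_eq_sum_vecMulVec.1 hB
  rw [Matrix.trace_sum, Matrix.sum_apply]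
  refine (Finset.abs_sum_le_sum_abs _ _).trans (Finset.sum_le_sum fun k _ => ?_)
  rw [Matrix.trace_vecMulVec, Matrix.vecMulVec_apply]
  simp only [star_trivial, dotProduct, abs_mul]
  have h : ∀ a, w k a * w k a ≤ ∑ b, w k b * w k b := fun a =>
    Finset.single_le_sum (f := fun b => w k b * w k b) (fun b _ => mul_self_nonneg _)
      (Finset.mem_univ a)
  have h1 := h i
  have h2 := h j
  rw [← abs_mul_abs_self] at h1 h2
  nlinarith [sq_nonneg (|w k i| - |w k j|)]

lemma isClosed_posSemidef : IsClosed {B : Matrix ι ι ℝ | B.PosSemidef} := by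
  have : {B : Matrix ι ι ℝ | B.PosSemidef}
      = {B | Bᵀ = B} ∩ ⋂ w : ι → ℝ, {B | 0 ≤ w ⬝ᵥ (B *ᵥ w)} := by
    ext B
    simp only [Set.mem_ofPred_eq, Set.mem_inter_iff, Set.mem_iInter]
    exact Matrix.posSemidef_iff_dotProduct_mulVec
  rw [this]
  refine IsClosed.inter (isClosed_eq (by fun_prop) continuous_id) (isClosed_iInter fun w => ?_)
  exact isClosed_le continuous_const (by fun_prop)

/-- The identity is an internal point of the cone within the symmetric matrices: `|wᵀ B w| ≤ s ‖w‖²`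
with `s` the sum of the absolute entries. -/
lemma exists_one_add_smul_posSemidef [DecidableEq ι] {B : Matrix ι ι ℝ} (hB : Bᵀ = B) :
    ∃ ε : ℝ, 0 < ε ∧ (1 + ε • B).PosSemidef := by
  set s := ∑ i, ∑ j, |B i j| with hs
  have hs0 : 0 ≤ s := Finset.sum_nonneg fun _ _ => Finset.sum_nonneg fun _ _ => abs_nonneg _
  refine ⟨(1 + s)⁻¹, by positivity, Matrix.PosSemidef.of_dotProduct_mulVec_nonneg ?_ fun w => ?_⟩
  · rw [Matrix.IsHermitian, Matrix.conjTranspose_eq_transpose_of_trivial, Matrix.transpose_add,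
      Matrix.transpose_smul, hB, Matrix.transpose_one]
  · have h : ∀ a, w a * w a ≤ w ⬝ᵥ w := fun a =>
      Finset.single_le_sum (f := fun b => w b * w b) (fun b _ => mul_self_nonneg _)
        (Finset.mem_univ a)
    have h1 : |w ⬝ᵥ (B *ᵥ w)| ≤ s * (w ⬝ᵥ w) := by
      have hexp : w ⬝ᵥ (B *ᵥ w) = ∑ i, ∑ j, w i * (B i j * w j) := by
        simp only [dotProduct, Matrix.mulVec, Finset.mul_sum]
      rw [hexp, hs, Finset.sum_mul]
      refine (Finset.abs_sum_le_sum_abs _ _).trans (Finset.sum_le_sum fun i _ => ?_)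
      rw [Finset.sum_mul]
      refine (Finset.abs_sum_le_sum_abs _ _).trans (Finset.sum_le_sum fun j _ => ?_)
      have hi := h i
      have hj := h j
      rw [← abs_mul_abs_self] at hi hj
      have : |w i| * |w j| ≤ w ⬝ᵥ w := by nlinarith [sq_nonneg (|w i| - |w j|)]
      calc |w i * (B i j * w j)| = |B i j| * (|w i| * |w j|) := by rw [abs_mul, abs_mul]; ring
        _ ≤ |B i j| * (w ⬝ᵥ w) := mul_le_mul_of_nonneg_left this (abs_nonneg _)
    have h2 := (abs_le.1 h1).1
    have h3 : 0 ≤ w ⬝ᵥ w := Finset.sum_nonneg fun _ _ => mul_self_nonneg _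
    rw [star_trivial, Matrix.add_mulVec, Matrix.one_mulVec, Matrix.smul_mulVec, dotProduct_add,
      dotProduct_smul, smul_eq_mul]
    have h4 : w ⬝ᵥ w + (1 + s)⁻¹ * (w ⬝ᵥ (B *ᵥ w))
        = (1 + s)⁻¹ * ((1 + s) * (w ⬝ᵥ w) + w ⬝ᵥ (B *ᵥ w)) := by field_simp
    rw [h4]
    exact mul_nonneg (by positivity) (by linarith)

end PosSemidef

/-! ### The Lagrangian and its infimum -/

section Lagrangian

variable {d : ℕ} {X : Set (E d)}
variable (H : Type*) [NormedAddCommGroup H] [InnerProductSpace ℝ H] [CompleteSpace H]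
variable [RKHS ℝ H X ℝ]
variable {n l : ℕ}

/-- The residual `Ψ_jᵀ B Ψ_j - ∑_{p,q} ⟪f, ∂_{pq} k_{v_j}⟫ e_p e_qᵀ` of the constraints. -/
def residual (v : Fin l → X) (R : Matrix (Fin l) (Fin l) ℝ) :
    H × Matrix (Fin l × Fin d) (Fin l × Fin d) ℝ →ₗ[ℝ] Fin l → Matrix (Fin d) (Fin d) ℝ where
  toFun Q j := (Psi d R j)ᵀ * Q.2 * Psi d R j
    - Matrix.of fun p q => inner ℝ Q.1 (dkx H (v j) p q)
  map_add' Q Q' := by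
    funext j
    ext p q
    simp only [Prod.fst_add, Prod.snd_add, Matrix.mul_add, Matrix.add_mul, inner_add_left,
      Pi.add_apply, Matrix.add_apply, Matrix.sub_apply, Matrix.of_apply]
    ring
  map_smul' c Q := by
    funext j
    ext p q
    simp only [Prod.smul_fst, Prod.smul_snd, Matrix.mul_smul, Matrix.smul_mul,
      real_inner_smul_left, Pi.smul_apply, Matrix.smul_apply, Matrix.sub_apply, Matrix.of_apply,
      smul_eq_mul, RingHom.id_apply]
    ring

variable {H}

lemma residual_apply (v : Fin l → X) (R : Matrix (Fin l) (Fin l) ℝ)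
    (Q : H × Matrix (Fin l × Fin d) (Fin l × Fin d) ℝ) (j : Fin l) :
    residual H v R Q j = (Psi d R j)ᵀ * Q.2 * Psi d R j
      - Matrix.of fun p q => inner ℝ Q.1 (dkx H (v j) p q) := rfl

lemma mem_feasible_iff {v : Fin l → X} {R : Matrix (Fin l) (Fin l) ℝ}
    {Q : H × Matrix (Fin l × Fin d) (Fin l × Fin d) ℝ} :
    Q ∈ feasible H v R ↔ Q.2.PosSemidef ∧ residual H v R Q = 0 := by
  refine and_congr_right fun _ => ?_
  rw [funext_iff]
  refine forall_congr' fun j => ?_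
  rw [residual_apply, Pi.zero_apply, sub_eq_zero, eq_comm]

lemma lagrangian_eq_add_residual (x : Fin n → X) (y : Fin n → ℝ) (v : Fin l → X)
    (R : Matrix (Fin l) (Fin l) ℝ) (ρ lam₁ lam₂ : ℝ) (f : H)
    (B : Matrix (Fin l × Fin d) (Fin l × Fin d) ℝ) (Γ : Fin l → Matrix (Fin d) (Fin d) ℝ) :
    lagrangian H x y v R ρ lam₁ lam₂ f B Γ = primalObj H x y ρ lam₁ lam₂ f B
      + ∑ j, ∑ p, ∑ q, Γ j p q * residual H v R (f, B) j p q := by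
  have h1 : ∀ j, ((Γ j)ᵀ * ((Psi d R j)ᵀ * B * Psi d R j)).trace
      = ∑ p, ∑ q, Γ j p q * ((Psi d R j)ᵀ * B * Psi d R j) p q := fun j =>
    trace_transpose_mul_eq_sum _ _
  have h2 : (inner ℝ f (∑ j, ∑ p, ∑ q, Γ j p q • dkx H (v j) p q) : ℝ)
      = ∑ j, ∑ p, ∑ q, Γ j p q * inner ℝ f (dkx H (v j) p q) := by
    simp only [inner_sum, real_inner_smul_right]
  rw [lagrangian, h2]
  simp only [h1, residual_apply, Matrix.sub_apply, Matrix.of_apply, mul_sub,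
    Finset.sum_sub_distrib]
  ring

lemma lagrangian_of_feasible (x : Fin n → X) (y : Fin n → ℝ) {v : Fin l → X}
    {R : Matrix (Fin l) (Fin l) ℝ} (ρ lam₁ lam₂ : ℝ)
    {Q : H × Matrix (Fin l × Fin d) (Fin l × Fin d) ℝ} (hQ : Q ∈ feasible H v R)
    (Γ : Fin l → Matrix (Fin d) (Fin d) ℝ) :
    lagrangian H x y v R ρ lam₁ lam₂ Q.1 Q.2 Γ = primalObj H x y ρ lam₁ lam₂ Q.1 Q.2 := by
  rw [lagrangian_eq_add_residual, (mem_feasible_iff.1 hQ).2]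
  simp

/-- The separation of variables behind the dual function. Cyclicity of the trace moves `Ψ_j` onto `Γ
j`, whose symmetry removes the transpose. -/
lemma lagrangian_eq_add_conePenalty (x : Fin n → X) (y : Fin n → ℝ) (v : Fin l → X)
    (R : Matrix (Fin l) (Fin l) ℝ) (ρ lam₁ lam₂ : ℝ) (f : H)
    (B : Matrix (Fin l × Fin d) (Fin l × Fin d) ℝ) {Γ : Fin l → Matrix (Fin d) (Fin d) ℝ}
    (hΓ : Γ ∈ SymTuples l d) :
    lagrangian H x y v R ρ lam₁ lam₂ f B Γ = ridgeObj x y ρ (multiplierElt H v Γ) f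
      + conePenalty lam₂ ((∑ j, Psi d R j * Γ j * (Psi d R j)ᵀ)
        + lam₁ • (1 : Matrix (Fin l × Fin d) (Fin l × Fin d) ℝ)) B := by
  have h1 : ∀ j, ((Γ j)ᵀ * ((Psi d R j)ᵀ * B * Psi d R j)).trace
      = (Psi d R j * Γ j * (Psi d R j)ᵀ * B).trace := fun j => by
    rw [hΓ j, ← Matrix.mul_assoc, Matrix.trace_mul_comm]
    simp only [Matrix.mul_assoc]
  rw [lagrangian, primalObj, ridgeObj, conePenalty, Matrix.add_mul, Matrix.trace_add,
    Matrix.smul_mul, Matrix.one_mul, Matrix.trace_smul, Matrix.sum_mul, Matrix.trace_sum,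
    multiplierElt, smul_eq_mul]
  simp only [h1]
  ring

lemma iInf_lagrangian (hXo : IsOpen X)
    (hk : ContDiffOn ℝ 4 (fun z : E d × E d => ker H z.1 z.2) (X ×ˢ X))
    (hn : 1 ≤ n) (x : Fin n → X) (y : Fin n → ℝ) (v : Fin l → X) (R : Matrix (Fin l) (Fin l) ℝ)
    {ρ : ℝ} (hρ : 0 < ρ) (lam₁ : ℝ) {lam₂ : ℝ} (hlam : 0 ≤ lam₂)
    {Γ : Fin l → Matrix (Fin d) (Fin d) ℝ} (hΓ : Γ ∈ SymTuples l d) :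
    (⨅ (f : H) (B : Matrix (Fin l × Fin d) (Fin l × Fin d) ℝ) (_ : B.PosSemidef),
        ((lagrangian H x y v R ρ lam₁ lam₂ f B Γ : ℝ) : EReal))
      = -dualObj H x y v R ρ lam₁ lam₂ Γ := by
  have hM : (∑ j, Psi d R j * Γ j * (Psi d R j)ᵀ).IsHermitian := by
    rw [Matrix.IsHermitian, Matrix.conjTranspose_eq_transpose_of_trivial, Matrix.transpose_sum]
    refine Finset.sum_congr rfl fun j _ => ?_
    rw [Matrix.transpose_mul, Matrix.transpose_mul, Matrix.transpose_transpose, hΓ j,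
      Matrix.mul_assoc]
  simp only [lagrangian_eq_add_conePenalty x y v R ρ lam₁ lam₂ _ _ hΓ]
  rw [iInf_add_conePenalty hlam hM (ridgeObj x y ρ (multiplierElt H v Γ))
    (ridgeMin x y ρ (multiplierElt H v Γ)) (ridgeObj_ridgeMin_le hn x y hρ _),
    ridgeObj_ridgeMin_eq_neg_dualQuad hXo hk hn x y v hρ, neg_neg, dualObj]

/-- Strong convexity of the Lagrangian in `f` at its minimizer. -/
lemma lagrangian_fStar_add_le (hXo : IsOpen X)
    (hk : ContDiffOn ℝ 4 (fun z : E d × E d => ker H z.1 z.2) (X ×ˢ X))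
    (hn : 1 ≤ n) (x : Fin n → X) (y : Fin n → ℝ) (v : Fin l → X) (R : Matrix (Fin l) (Fin l) ℝ)
    {ρ : ℝ} (hρ : 0 < ρ) (lam₁ lam₂ : ℝ)
    {Γ : Fin l → Matrix (Fin d) (Fin d) ℝ} (hΓ : Γ ∈ SymTuples l d) (f : H)
    (B : Matrix (Fin l × Fin d) (Fin l × Fin d) ℝ) :
    lagrangian H x y v R ρ lam₁ lam₂ (fStar H x y v ρ Γ) B Γ
      + ρ * ‖f - fStar H x y v ρ Γ‖ ^ 2 ≤ lagrangian H x y v R ρ lam₁ lam₂ f B Γ := by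
  rw [lagrangian_eq_add_conePenalty x y v R ρ lam₁ lam₂ _ _ hΓ,
    lagrangian_eq_add_conePenalty x y v R ρ lam₁ lam₂ _ _ hΓ, fStar_eq_ridgeMin hXo hk,
    ridgeObj_eq hn x y hρ _ f]
  have : 0 ≤ 1 / (n : ℝ) * ∑ i, (f (x i) - ridgeMin x y ρ (multiplierElt H v Γ) (x i)) ^ 2 :=
    mul_nonneg (by positivity) (Finset.sum_nonneg fun _ _ => sq_nonneg _)
  linarith

end Lagrangian

/-! ### Convexity of the primal objective -/

section Convexity

variable {d : ℕ} {X : Set (E d)}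
variable {H : Type*} [NormedAddCommGroup H] [InnerProductSpace ℝ H] [RKHS ℝ H X ℝ]
variable {n l : ℕ}

lemma convexOn_sq_of_affine {Y : Type*} [AddCommGroup Y] [Module ℝ Y] {C : Set Y}
    (hC : Convex ℝ C) {L : Y → ℝ}
    (hL : ∀ u w : Y, ∀ a b : ℝ, a + b = 1 → L (a • u + b • w) = a * L u + b * L w) :
    ConvexOn ℝ C fun u => L u ^ 2 := by
  refine ⟨hC, fun u _ w _ a b ha hb hab => ?_⟩
  simp only [hL u w a b hab, smul_eq_mul]
  obtain rfl : b = 1 - a := by linarith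
  nlinarith [mul_nonneg (mul_nonneg ha hb) (sq_nonneg (L u - L w))]

lemma convexOn_primalObj (x : Fin n → X) (y : Fin n → ℝ) {ρ lam₁ lam₂ : ℝ} (hρ : 0 ≤ ρ)
    (h₂ : 0 ≤ lam₂) :
    ConvexOn ℝ {Q : H × Matrix (Fin l × Fin d) (Fin l × Fin d) ℝ | Q.2.PosSemidef}
      fun Q => primalObj H x y ρ lam₁ lam₂ Q.1 Q.2 := by
  have hC : Convex ℝ {Q : H × Matrix (Fin l × Fin d) (Fin l × Fin d) ℝ | Q.2.PosSemidef} :=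
    fun _ hu _ hw _ _ ha hb _ =>
      (Matrix.PosSemidef.smul hu ha).add (Matrix.PosSemidef.smul hw hb)
  have hsum : ∀ {κ : Type} (F : Finset κ)
      (φ : κ → H × Matrix (Fin l × Fin d) (Fin l × Fin d) ℝ → ℝ),
      (∀ i, ConvexOn ℝ {Q : H × Matrix (Fin l × Fin d) (Fin l × Fin d) ℝ | Q.2.PosSemidef} (φ i)) →
      ConvexOn ℝ {Q : H × Matrix (Fin l × Fin d) (Fin l × Fin d) ℝ | Q.2.PosSemidef}
        fun Q => ∑ i ∈ F, φ i Q := by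
    intro κ F φ h
    classical
    induction F using Finset.induction_on with
    | empty => simpa using convexOn_const 0 hC
    | insert a F ha ih =>
      simp only [Finset.sum_insert ha]
      exact (h a).add ih
  have h1 : ConvexOn ℝ {Q : H × Matrix (Fin l × Fin d) (Fin l × Fin d) ℝ | Q.2.PosSemidef}
      fun Q => ∑ i, (y i - Q.1 (x i)) ^ 2 :=
    hsum _ _ fun i => convexOn_sq_of_affine hC fun u w a b hab => by
      simp only [Prod.fst_add, Prod.smul_fst, RKHS.coe_add, RKHS.coe_smul, Pi.add_apply,
        Pi.smul_apply, smul_eq_mul]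
      linear_combination (-y i) * hab
  have h2 : ConvexOn ℝ {Q : H × Matrix (Fin l × Fin d) (Fin l × Fin d) ℝ | Q.2.PosSemidef}
      fun Q => lam₁ * Q.2.trace := by
    refine ⟨hC, fun u _ w _ a b ha hb hab => le_of_eq ?_⟩
    simp only [Prod.snd_add, Prod.smul_snd, Matrix.trace_add, Matrix.trace_smul, smul_eq_mul]
    ring
  have h3 : ConvexOn ℝ {Q : H × Matrix (Fin l × Fin d) (Fin l × Fin d) ℝ | Q.2.PosSemidef}
      fun Q => frobSq Q.2 :=
    hsum _ _ fun i => hsum _ _ fun j => convexOn_sq_of_affine hC fun u w a b hab => by simp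
  have h4 : ConvexOn ℝ {Q : H × Matrix (Fin l × Fin d) (Fin l × Fin d) ℝ | Q.2.PosSemidef}
      fun Q => ‖Q.1‖ ^ 2 := by
    have h5 : ConvexOn ℝ Set.univ fun f : H => ‖f‖ ^ 2 :=
      convexOn_univ_norm.pow (fun _ _ => norm_nonneg _) 2
    exact (h5.comp_linearMap (LinearMap.fst ℝ H _)).subset (Set.subset_univ _) hC
  have h6 := (((h1.smul (c := 1 / (n : ℝ)) (by positivity)).add h2).add
    (h3.smul (c := lam₂ / 2) (by positivity))).add (h4.smul hρ)
  exact h6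

end Convexity

/-! ### Slater's condition and the optimal dual variable -/

section Slater

variable {d : ℕ} {X : Set (E d)}
variable {H : Type*} [NormedAddCommGroup H] [InnerProductSpace ℝ H] [CompleteSpace H]
variable [RKHS ℝ H X ℝ]
variable {n l : ℕ}

lemma Psi_transpose_mul_Psi (R : Matrix (Fin l) (Fin l) ℝ) (j : Fin l) :
    (Psi d R j)ᵀ * Psi d R j = ((Rᵀ * R) j j) • (1 : Matrix (Fin d) (Fin d) ℝ) := by
  ext p q
  simp only [Matrix.mul_apply, Psi, Matrix.transpose_apply, Matrix.of_apply,
    Fintype.sum_prod_type, Matrix.smul_apply, smul_eq_mul, Finset.sum_mul]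
  refine Finset.sum_congr rfl fun a _ => ?_
  simp only [Matrix.one_apply, mul_ite, mul_one, mul_zero, ite_mul, zero_mul, Finset.sum_ite_eq',
    Finset.mem_univ, if_true]
  by_cases h : p = q
  · simp [h]
  · simp [h, Ne.symm h]

lemma exists_residual_one_eq_zero (hXo : IsOpen X)
    (hk : ContDiffOn ℝ 4 (fun z : E d × E d => ker H z.1 z.2) (X ×ˢ X)) (s : ℕ)
    (hCs : ∀ g : E d → ℝ, ContDiff ℝ s g → ∃ f : H, ∀ z : X, f z = g z)
    (v : Fin l → X) {R : Matrix (Fin l) (Fin l) ℝ} (hR : IsCholesky R (gram H v)) :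
    ∃ f : H, residual H v R (f, 1) = 0 := by
  -- The required Hessian `k(z, z) I` depends only on the point, so repetitions among the `v j` are
  -- harmless.
  obtain ⟨g, hg, hg2⟩ := exists_contDiff_pd2 (Finset.univ.image fun j => (v j : E d))
    (fun z => ker H z z) s
  obtain ⟨f, hf⟩ := hCs g hg
  refine ⟨f, ?_⟩
  funext j
  rw [residual_apply, Matrix.mul_one, Psi_transpose_mul_Psi, hR.2, Pi.zero_apply, sub_eq_zero]
  ext p q
  rw [Matrix.of_apply, inner_dkx hXo hk]
  have h1 : pd2 p q (ext0 f) (v j : E d) = pd2 p q g (v j : E d) := by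
    refine pd2_congr ?_ p q
    filter_upwards [hXo.mem_nhds (v j).2] with z hz
    lift z to X using hz
    rw [ext0_apply, hf]
  rw [h1, hg2 _ (Finset.mem_image_of_mem _ (Finset.mem_univ j))]
  simp [Matrix.one_apply, gram]

lemma slater (hXo : IsOpen X)
    (hk : ContDiffOn ℝ 4 (fun z : E d × E d => ker H z.1 z.2) (X ×ˢ X)) (s : ℕ)
    (hCs : ∀ g : E d → ℝ, ContDiff ℝ s g → ∃ f : H, ∀ z : X, f z = g z)
    (v : Fin l → X) {R : Matrix (Fin l) (Fin l) ℝ} (hR : IsCholesky R (gram H v))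
    (Q : H × Matrix (Fin l × Fin d) (Fin l × Fin d) ℝ) (hQ : Q.2ᵀ = Q.2) :
    ∃ ε : ℝ, 0 < ε ∧ ∃ Q' : H × Matrix (Fin l × Fin d) (Fin l × Fin d) ℝ,
      Q'.2.PosSemidef ∧ residual H v R Q' = ε • residual H v R Q := by
  obtain ⟨f₀, hf₀⟩ := exists_residual_one_eq_zero hXo hk s hCs v hR
  obtain ⟨ε, hε, hpsd⟩ := exists_one_add_smul_posSemidef hQ
  refine ⟨ε, hε, (f₀, 1) + ε • Q, hpsd, ?_⟩
  rw [map_add, map_smul, hf₀, zero_add]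

/-- Mixed partials commute, so a multiplier may be symmetrized without changing its pairing with the
residual. -/
lemma residual_symm (hXo : IsOpen X)
    (hk : ContDiffOn ℝ 4 (fun z : E d × E d => ker H z.1 z.2) (X ×ˢ X))
    (v : Fin l → X) (R : Matrix (Fin l) (Fin l) ℝ)
    {Q : H × Matrix (Fin l × Fin d) (Fin l × Fin d) ℝ} (hQ : Q.2ᵀ = Q.2) (j : Fin l)
    (p q : Fin d) : residual H v R Q j p q = residual H v R Q j q p := by
  have h1 : ((Psi d R j)ᵀ * Q.2 * Psi d R j)ᵀ = (Psi d R j)ᵀ * Q.2 * Psi d R j := by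
    rw [Matrix.transpose_mul, Matrix.transpose_mul, Matrix.transpose_transpose, hQ,
      Matrix.mul_assoc]
  rw [residual_apply, Matrix.sub_apply, Matrix.sub_apply, Matrix.of_apply, Matrix.of_apply,
    dkx_symm hXo hk (v j) p q]
  congr 1
  conv_lhs => rw [← h1]
  rfl

/-- Existence of an optimal dual variable. -/
theorem exists_symmetric_multiplier (hXo : IsOpen X)
    (hk : ContDiffOn ℝ 4 (fun z : E d × E d => ker H z.1 z.2) (X ×ˢ X)) (s : ℕ)
    (hCs : ∀ g : E d → ℝ, ContDiff ℝ s g → ∃ f : H, ∀ z : X, f z = g z)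
    (x : Fin n → X) (y : Fin n → ℝ) (v : Fin l → X) {R : Matrix (Fin l) (Fin l) ℝ}
    (hR : IsCholesky R (gram H v)) {ρ lam₁ lam₂ : ℝ} (hρ : 0 ≤ ρ) (h₂ : 0 ≤ lam₂) {P : ℝ}
    (hP : ∀ Q ∈ feasible H v R, P ≤ primalObj H x y ρ lam₁ lam₂ Q.1 Q.2) :
    ∃ Γ ∈ SymTuples l d, ∀ (f : H) (B : Matrix (Fin l × Fin d) (Fin l × Fin d) ℝ),
      B.PosSemidef → P ≤ lagrangian H x y v R ρ lam₁ lam₂ f B Γ := by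
  -- Slater's condition can be asked only along symmetric `B`, the directions in which the identity
  -- is internal to the cone.
  let S : Submodule ℝ (H × Matrix (Fin l × Fin d) (Fin l × Fin d) ℝ) :=
    { carrier := {Q | Q.2ᵀ = Q.2}
      zero_mem' := by simp
      add_mem' := by
        intro Q Q' h h'
        change (Q.2 + Q'.2)ᵀ = Q.2 + Q'.2
        rw [Matrix.transpose_add, h, h']
      smul_mem' := by
        intro c Q h
        change (c • Q.2)ᵀ = c • Q.2
        rw [Matrix.transpose_smul, h] }
  obtain ⟨Λ, hΛ⟩ := exists_lagrange_multiplier (S := S)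
    (C := {Q : H × Matrix (Fin l × Fin d) (Fin l × Fin d) ℝ | Q.2.PosSemidef})
    (fun Q hQ => hQ.isHermitian) (convexOn_primalObj x y (lam₁ := lam₁) hρ h₂) (residual H v R)
    (fun Q hQ => slater hXo hk s hCs v hR Q hQ) (P := P)
    (fun Q hQ hQ0 => hP Q (mem_feasible_iff.2 ⟨hQ, hQ0⟩))
  obtain ⟨A, hA⟩ := exists_coeff_of_linearMap Λ
  refine ⟨fun j => (1 / 2 : ℝ) • (A j + (A j)ᵀ), fun j => ?_, fun f B hB => ?_⟩
  · rw [Matrix.IsSymm, Matrix.transpose_smul, Matrix.transpose_add, Matrix.transpose_transpose,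
      add_comm]
  · refine (hΛ (f, B) hB).trans (le_of_eq ?_)
    rw [lagrangian_eq_add_residual, hA]
    congr 1
    refine Finset.sum_congr rfl fun j _ => ?_
    have h1 : ∑ p, ∑ q, A j q p * residual H v R (f, B) j p q
        = ∑ p, ∑ q, A j p q * residual H v R (f, B) j p q := by
      rw [Finset.sum_comm]
      refine Finset.sum_congr rfl fun p _ => Finset.sum_congr rfl fun q _ => ?_
      rw [residual_symm hXo hk v R (Q := (f, B)) hB.isHermitian]
    have h2 : ∀ p q, ((1 / 2 : ℝ) • (A j + (A j)ᵀ)) p q * residual H v R (f, B) j p q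
        = 1 / 2 * (A j p q * residual H v R (f, B) j p q)
          + 1 / 2 * (A j q p * residual H v R (f, B) j p q) := fun p q => by
      simp only [Matrix.smul_apply, Matrix.add_apply, Matrix.transpose_apply, smul_eq_mul]
      ring
    simp only [h2, Finset.sum_add_distrib, ← Finset.mul_sum, h1]
    ring

end Slater

/-! ### Existence of a primal minimizer -/

section Existence

variable {d : ℕ} {X : Set (E d)}
variable {H : Type*} [NormedAddCommGroup H] [InnerProductSpace ℝ H] [CompleteSpace H]
variable [RKHS ℝ H X ℝ]
variable {n l : ℕ}

lemma penalty_nonneg {ι : Type*} [Fintype ι] {lam₁ lam₂ : ℝ} (h₁ : 0 ≤ lam₁) (h₂ : 0 ≤ lam₂)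
    {B : Matrix ι ι ℝ} (hB : B.PosSemidef) : 0 ≤ lam₁ * B.trace + lam₂ / 2 * frobSq B :=
  add_nonneg (mul_nonneg h₁ hB.trace_nonneg) (mul_nonneg (by positivity) (frobSq_nonneg B))

/-- Coercivity of the matrix penalty. -/
lemma exists_abs_entry_le_of_penalty_le {ι : Type*} [Fintype ι] {lam₁ lam₂ : ℝ}
    (hlam : (0 < lam₂ ∧ 0 ≤ lam₁) ∨ (lam₂ = 0 ∧ 0 < lam₁)) (c : ℝ) :
    ∃ r : ℝ, ∀ B : Matrix ι ι ℝ, B.PosSemidef → lam₁ * B.trace + lam₂ / 2 * frobSq B ≤ c →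
      ∀ i j, |B i j| ≤ r := by
  rcases hlam with ⟨h2, h1⟩ | ⟨rfl, h1⟩
  -- The bound comes from `t ≤ 1 + t²` applied to `|B i j|`.
  · refine ⟨1 + c / (lam₂ / 2), fun B hB hc i j => ?_⟩
    have h3 := mul_nonneg h1 hB.trace_nonneg
    have h4 : frobSq B ≤ c / (lam₂ / 2) := by
      rw [le_div_iff₀ (by positivity)]
      linarith
    have h5 : B i j ^ 2 ≤ frobSq B :=
      (Finset.single_le_sum (f := fun j => B i j ^ 2) (fun _ _ => sq_nonneg _)
        (Finset.mem_univ j)).trans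
      (Finset.single_le_sum (f := fun i => ∑ j, B i j ^ 2)
        (fun _ _ => Finset.sum_nonneg fun _ _ => sq_nonneg _) (Finset.mem_univ i))
    rw [← sq_abs] at h5
    nlinarith [sq_nonneg (|B i j| - 1), abs_nonneg (B i j)]
  · refine ⟨c / lam₁, fun B hB hc i j => (abs_entry_le_trace hB i j).trans ?_⟩
    rw [le_div_iff₀ h1]
    linarith

/-- A finite dimensional space of functions that contains a primal minimizer. -/
def representerSpace (x : Fin n → X) (v : Fin l → X) : Submodule ℝ H :=
  Submodule.span ℝ (Set.range (fun i => kx H (x i)) ∪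
    Set.range fun a : Fin l × Fin d × Fin d => dkx H (v a.1) a.2.1 a.2.2)

instance (x : Fin n → X) (v : Fin l → X) :
    FiniteDimensional ℝ (representerSpace (H := H) x v) :=
  FiniteDimensional.span_of_finite ℝ ((Set.finite_range _).union (Set.finite_range _))

/-- Data and constraints see `f` only through inner products with the spanning elements. Orthogonal
projection keeps these and does not increase the norm. -/
lemma exists_representer (x : Fin n → X) (v : Fin l → X) (f : H) :
    ∃ g : representerSpace (H := H) x v, ‖g‖ ≤ ‖f‖ ∧ (∀ i, (g : H) (x i) = f (x i)) ∧
      ∀ j p q, (inner ℝ (g : H) (dkx H (v j) p q) : ℝ) = inner ℝ f (dkx H (v j) p q) := by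
  have key : ∀ w ∈ representerSpace (H := H) x v,
      (inner ℝ (((representerSpace (H := H) x v).orthogonalProjectionOnto f : H)) w : ℝ)
        = inner ℝ f w := fun w hw =>
    Submodule.inner_orthogonalProjectionOnto_eq_of_mem_right ⟨w, hw⟩ f
  refine ⟨(representerSpace (H := H) x v).orthogonalProjectionOnto f,
    Submodule.norm_orthogonalProjectionOnto_apply_le _ f, fun i => ?_, fun j p q => ?_⟩
  · have := key _ (Submodule.subset_span (Or.inl ⟨i, rfl⟩))
    rwa [inner_kx, inner_kx] at this
  · exact key _ (Submodule.subset_span (Or.inr ⟨(j, p, q), rfl⟩))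

/-- The primal problem has a minimizer as soon as it is feasible. -/
theorem exists_primal_minimizer (x : Fin n → X) (y : Fin n → ℝ) (v : Fin l → X)
    (R : Matrix (Fin l) (Fin l) ℝ) {ρ lam₁ lam₂ : ℝ} (hρ : 0 < ρ)
    (hlam : (0 < lam₂ ∧ 0 ≤ lam₁) ∨ (lam₂ = 0 ∧ 0 < lam₁)) (hne : (feasible H v R).Nonempty) :
    ∃ Q ∈ feasible H v R, ∀ Q' ∈ feasible H v R,
      primalObj H x y ρ lam₁ lam₂ Q.1 Q.2 ≤ primalObj H x y ρ lam₁ lam₂ Q'.1 Q'.2 := by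
  have h₁ : 0 ≤ lam₁ := by rcases hlam with h | h; exacts [h.2, h.2.le]
  have h₂ : 0 ≤ lam₂ := by rcases hlam with h | h; exacts [h.1.le, h.1.ge]
  let S := representerSpace (H := H) x v
  let emb : S × Matrix (Fin l × Fin d) (Fin l × Fin d) ℝ →
    H × Matrix (Fin l × Fin d) (Fin l × Fin d) ℝ := fun Q => (Q.1, Q.2)
  let obj : S × Matrix (Fin l × Fin d) (Fin l × Fin d) ℝ → ℝ := fun Q =>
    primalObj H x y ρ lam₁ lam₂ Q.1 Q.2
  have hproj : ∀ Q ∈ feasible H v R, ∃ Q' : S × Matrix (Fin l × Fin d) (Fin l × Fin d) ℝ,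
      emb Q' ∈ feasible H v R ∧ obj Q' ≤ primalObj H x y ρ lam₁ lam₂ Q.1 Q.2 := by
    rintro ⟨f, B⟩ ⟨hB, hfB⟩
    obtain ⟨g, hg1, hg2, hg3⟩ := exists_representer x v f
    refine ⟨(g, B), ⟨hB, fun j => ?_⟩, ?_⟩
    · rw [← hfB j]
      ext p q
      exact hg3 j p q
    · have h3 : ‖(g : H)‖ ^ 2 ≤ ‖f‖ ^ 2 := pow_le_pow_left₀ (norm_nonneg _) hg1 2
      simp only [obj, primalObj, hg2]
      linarith [mul_le_mul_of_nonneg_left h3 hρ.le]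
  have hcont : Continuous obj := by
    have e1 : ∀ i, Continuous fun Q : S × Matrix (Fin l × Fin d) (Fin l × Fin d) ℝ =>
        (Q.1 : H) (x i) := fun i =>
      (RKHS.continuous_eval (H := H) (x i)).comp (continuous_subtype_val.comp continuous_fst)
    have e2 : Continuous fun Q : S × Matrix (Fin l × Fin d) (Fin l × Fin d) ℝ => Q.2.trace :=
      continuous_snd.matrix_trace
    have e3 : Continuous fun Q : S × Matrix (Fin l × Fin d) (Fin l × Fin d) ℝ => frobSq Q.2 :=
      continuous_finsetSum _ fun i _ => continuous_finsetSum _ fun j _ =>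
        (continuous_snd.matrix_elem i j).pow 2
    simp only [obj, primalObj]
    fun_prop
  have hclosed : IsClosed {Q : S × Matrix (Fin l × Fin d) (Fin l × Fin d) ℝ |
      emb Q ∈ feasible H v R} := by
    have : {Q : S × Matrix (Fin l × Fin d) (Fin l × Fin d) ℝ | emb Q ∈ feasible H v R}
        = Prod.snd ⁻¹' {B : Matrix (Fin l × Fin d) (Fin l × Fin d) ℝ | B.PosSemidef} ∩
          ⋂ j, {Q : S × Matrix (Fin l × Fin d) (Fin l × Fin d) ℝ |
            (Matrix.of fun p q => (inner ℝ (Q.1 : H) (dkx H (v j) p q) : ℝ)) =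
              (Psi d R j)ᵀ * Q.2 * Psi d R j} := by
      ext Q
      simp only [Set.mem_inter_iff, Set.mem_iInter]
      rfl
    rw [this]
    refine (isClosed_posSemidef.preimage continuous_snd).inter (isClosed_iInter fun j => ?_)
    refine isClosed_eq (continuous_matrix fun p q => ?_) ?_
    · simp only [Matrix.of_apply]
      fun_prop
    · fun_prop
  obtain ⟨Q₀, hQ₀⟩ := hne
  obtain ⟨Q₁, hQ₁, -⟩ := hproj Q₀ hQ₀
  obtain ⟨r, hr⟩ := exists_abs_entry_le_of_penalty_le (ι := Fin l × Fin d) hlam (obj Q₁)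
  -- The feasible sublevel set through `Q₁`: it is closed, and the ridge term and the matrix penalty
  -- bound it, so it is compact.
  let K : Set (S × Matrix (Fin l × Fin d) (Fin l × Fin d) ℝ) :=
    {Q | emb Q ∈ feasible H v R} ∩ {Q | obj Q ≤ obj Q₁}
  let box : Set (Matrix (Fin l × Fin d) (Fin l × Fin d) ℝ) :=
    Set.univ.pi fun _ => Set.univ.pi fun _ => Set.Icc (-r) r
  have hbox : IsCompact (Metric.closedBall (0 : S) (1 + obj Q₁ / ρ) ×ˢ box) :=
    (isCompact_closedBall _ _).prod
      (isCompact_univ_pi fun _ => isCompact_univ_pi fun _ => isCompact_Icc)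
  have hK : IsCompact K := by
    refine hbox.of_isClosed_subset (hclosed.inter (isClosed_le hcont continuous_const)) ?_
    rintro ⟨g, B⟩ ⟨⟨hB, -⟩, hle⟩
    replace hB : B.PosSemidef := hB
    replace hle : 1 / (n : ℝ) * ∑ i, (y i - (g : H) (x i)) ^ 2 + lam₁ * B.trace
      + lam₂ / 2 * frobSq B + ρ * ‖(g : H)‖ ^ 2 ≤ obj Q₁ := hle
    have e1 : 0 ≤ 1 / (n : ℝ) * ∑ i, (y i - (g : H) (x i)) ^ 2 :=
      mul_nonneg (by positivity) (Finset.sum_nonneg fun _ _ => sq_nonneg _)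
    have e2 := penalty_nonneg h₁ h₂ hB
    have e3 : 0 ≤ ρ * ‖(g : H)‖ ^ 2 := by positivity
    refine ⟨?_, ?_⟩
    · rw [mem_closedBall_zero_iff]
      change ‖(g : H)‖ ≤ _
      have e4 : ‖(g : H)‖ ^ 2 ≤ obj Q₁ / ρ := by
        rw [le_div_iff₀ hρ]
        linarith
      nlinarith [sq_nonneg (‖(g : H)‖ - 1), norm_nonneg (g : H)]
    · intro i _ j _
      exact abs_le.1 (hr B hB (by linarith) i j)
  obtain ⟨Q₂, hQ₂, hmin⟩ := hK.exists_isMinOn ⟨Q₁, hQ₁, le_refl (obj Q₁)⟩ hcont.continuousOn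
  refine ⟨emb Q₂, hQ₂.1, fun Q hQ => ?_⟩
  obtain ⟨Q', hQ', hle⟩ := hproj Q hQ
  refine le_trans ?_ hle
  rcases le_total (obj Q') (obj Q₁) with h | h
  · exact hmin ⟨hQ', h⟩
  · exact le_trans hQ₂.2 h

end Existence

end CvxReg

end

/-! ### The proposition -/

open CvxReg
theorem mainTheorem9
    {d : ℕ} {X : Set (E d)} (hXo : IsOpen X) (hXb : Bornology.IsBounded X)
    (H : Type*) [NormedAddCommGroup H] [InnerProductSpace ℝ H] [CompleteSpace H]
    [RKHS ℝ H X ℝ]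
    (hk : ContDiffOn ℝ 4 (fun z : E d × E d => ker H z.1 z.2) (X ×ˢ X))
    (s : ℕ) (hs : 1 ≤ s)
    (hCs : ∀ g : E d → ℝ, ContDiff ℝ s g → ∃ f : H, ∀ z : X, f z = g z)
    {n l : ℕ} (hn : 1 ≤ n) (x : Fin n → X) (y : Fin n → ℝ) (v : Fin l → X)
    (R : Matrix (Fin l) (Fin l) ℝ) (hR : IsCholesky R (gram H v))
    (ρ lam₁ lam₂ : ℝ) (hρ : 0 < ρ)
    (hlam : (0 < lam₂ ∧ 0 ≤ lam₁) ∨ (lam₂ = 0 ∧ 0 < lam₁)) :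
    -- the elements `∂_{pq} k_u` of `H` exist and reproduce second derivatives
    (∀ (u : X) (p q : Fin d),
      (∀ z : X, dkx H u p q z = pd2 p q (fun t => ker H t z) u) ∧
      (∀ f : H, inner ℝ f (dkx H u p q) = pd2 p q (ext0 f) u)) ∧
    -- the dual objective is the negative of the Lagrangian dual function
    (∀ Γ ∈ SymTuples l d,
      (⨅ (f : H) (B : Matrix (Fin l × Fin d) (Fin l × Fin d) ℝ) (_ : B.PosSemidef),
        ((lagrangian H x y v R ρ lam₁ lam₂ f B Γ : ℝ) : EReal))
      = -dualObj H x y v R ρ lam₁ lam₂ Γ) ∧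
    -- strong duality, with both optimal values attained
    (∃ P : ℝ,
      IsLeast ((fun Q : H × Matrix (Fin l × Fin d) (Fin l × Fin d) ℝ =>
        primalObj H x y ρ lam₁ lam₂ Q.1 Q.2) '' feasible H v R) P ∧
      IsLeast (dualObj H x y v R ρ lam₁ lam₂ '' SymTuples l d) ((-P : ℝ) : EReal)) ∧
    -- the primal solution is recovered from any dual solution
    (∀ Γ ∈ SymTuples l d,
      IsMinOn (dualObj H x y v R ρ lam₁ lam₂) (SymTuples l d) Γ →
      ∀ Q ∈ feasible H v R,
        IsMinOn (fun Q : H × Matrix (Fin l × Fin d) (Fin l × Fin d) ℝ =>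
          primalObj H x y ρ lam₁ lam₂ Q.1 Q.2) (feasible H v R) Q →
        Q.1 = fStar H x y v ρ Γ) := by
  have h₂ : 0 ≤ lam₂ := by rcases hlam with h | h; exacts [h.1.le, h.1.ge]
  have hdual := fun Γ (hΓ : Γ ∈ SymTuples l d) =>
    iInf_lagrangian hXo hk hn x y v R hρ lam₁ h₂ hΓ
  obtain ⟨f₀, hf₀⟩ := exists_residual_one_eq_zero hXo hk s hCs v hR
  obtain ⟨Q₀, hQ₀, hQmin⟩ := exists_primal_minimizer x y v R hρ hlam
    ⟨(f₀, 1), mem_feasible_iff.2 ⟨Matrix.PosSemidef.one, hf₀⟩⟩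
  set P := primalObj H x y ρ lam₁ lam₂ Q₀.1 Q₀.2 with hP
  obtain ⟨Γ₀, hΓ₀, hΓ₀P⟩ :=
    exists_symmetric_multiplier hXo hk s hCs x y v hR hρ.le h₂ hQmin
  have hweak : ∀ Γ ∈ SymTuples l d, ((-P : ℝ) : EReal) ≤ dualObj H x y v R ρ lam₁ lam₂ Γ := by
    intro Γ hΓ
    rw [EReal.coe_neg, EReal.neg_le, ← hdual Γ hΓ]
    refine (iInf_le _ Q₀.1).trans ((iInf_le _ Q₀.2).trans ((iInf_le _ hQ₀.1).trans ?_))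
    rw [lagrangian_of_feasible x y ρ lam₁ lam₂ hQ₀]
  have hΓ₀eq : dualObj H x y v R ρ lam₁ lam₂ Γ₀ = ((-P : ℝ) : EReal) := by
    refine le_antisymm ?_ (hweak Γ₀ hΓ₀)
    rw [EReal.coe_neg, EReal.le_neg, ← hdual Γ₀ hΓ₀]
    exact le_iInf fun f => le_iInf fun B => le_iInf fun hB =>
      EReal.coe_le_coe_iff.2 (hΓ₀P f B hB)
  refine ⟨fun u p q => ⟨dkx_apply hXo hk u p q, inner_dkx hXo hk u p q⟩, hdual,
    ⟨P, ⟨⟨Q₀, hQ₀, rfl⟩, ?_⟩, ⟨⟨Γ₀, hΓ₀, hΓ₀eq⟩, ?_⟩⟩, ?_⟩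
  · rintro _ ⟨Q, hQ, rfl⟩
    exact hQmin Q hQ
  · rintro _ ⟨Γ, hΓ, rfl⟩
    exact hweak Γ hΓ
  · intro Γ hΓ hΓmin Q hQ hQmin'
    have h1 : dualObj H x y v R ρ lam₁ lam₂ Γ ≤ ((-P : ℝ) : EReal) :=
      hΓ₀eq ▸ hΓmin hΓ₀
    -- Dual optimality makes the infimum of the Lagrangian at `Γ` at least `P`, in particular at
    -- `(fStar, Q.2)`. The Lagrangian at `Q` is at most `P` and exceeds the former by `ρ ‖Q.1 -
    -- fStar‖²` or more, so this term vanishes; optimality of `Q.2` for the `B` part is not needed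
    -- separately.
    have h3 : (P : EReal) ≤
        ((lagrangian H x y v R ρ lam₁ lam₂ (fStar H x y v ρ Γ) Q.2 Γ : ℝ) : EReal) := by
      rw [EReal.coe_neg, EReal.le_neg, ← hdual Γ hΓ] at h1
      exact h1.trans ((iInf_le _ _).trans ((iInf_le _ Q.2).trans (iInf_le _ hQ.1)))
    have h4 := EReal.coe_le_coe_iff.1 h3
    have h5 := lagrangian_fStar_add_le hXo hk hn x y v R hρ lam₁ lam₂ hΓ Q.1 Q.2
    rw [lagrangian_of_feasible x y ρ lam₁ lam₂ hQ] at h5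
    have h6 : primalObj H x y ρ lam₁ lam₂ Q.1 Q.2 ≤ P := hQmin' hQ₀
    have h7 : ρ * ‖Q.1 - fStar H x y v ρ Γ‖ ^ 2 ≤ 0 := by linarith
    have h8 : ‖Q.1 - fStar H x y v ρ Γ‖ ^ 2 = 0 :=
      le_antisymm (nonpos_of_mul_nonpos_right h7 hρ) (sq_nonneg _)
    exact sub_eq_zero.1 (norm_eq_zero.1 (pow_eq_zero_iff two_ne_zero |>.1 h8))
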